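/- Shift spaces are closed shift-invariant subsets $X\subseteq A^{\mathbb Z}$ with $A$ finite, with left shift $T$; a sofic shift is the image of a shift of finite type under a factor code (a continuous shift-commuting surjection between shift spaces). Measures are Borel probability measures. A point $x\in X$ is generic for $\mu$ if $\frac1n\sum_{k<n}f(T^kx)\to\int f\,d\mu$ for every continuous $f:X\to\mathbb R$. Let $X$ be an irreducible sofic shift and $\pi:X\to Y$ a finite-to-one factor code (every fiber is finite). Let $d_\pi$ be its degree, i.e. the number such that every doubly transitive point of $Y$ (one in which every word of $Y$ occurs infinitely often to the left and to the right) has exactly $d_\pi$ preimages. Let $\nu$ be a fully supported ergodic measure on $Y$. An ergodic lift of $\nu$ is an ergodic measure $\mu$ on $X$ with $\pi\mu=\nu$. A degree joining over $\nu$ is a measure $\lambda$ on $X^{d_\pi}$, invariant and ergodic under the diagonal shift, such that for $\lambda$-a.e. $(x_1,\dots,x_{d_\pi})$ the points $x_i$ are pairwise distinct and $\pi(x_1)=\dots=\pi(x_{d_\pi})$, and such that every margin $p_i\lambda$ satisfies $\pi p_i\lambda=\nu$. The multiplicity of an ergodic lift $\mu$ of $\nu$ is $m_\pi(\mu)=\#\{i: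 p_i\lambda=\mu\}$, where $\lambda$ is a degree joining over $\nu$. Theorem. The measure $\nu$ has only finitely many ergodic lifts $\mu_1,\dots,\mu_k$ (distinct), and their multiplicities $m_1,\dots,m_k$ do not depend on the choice of the degree joining. For $\nu$-a.e. $y\in Y$, each point of the fiber $\pi^{-1}(y)$ is generic for exactly one of the ergodic lifts of $\nu$, and for each $i$ the fiber contains exactly $m_i$ points that are generic for $\mu_i$; that is, $\pi^{-1}(y)$ consists of $m_1$ points generic for $\mu_1$, $m_2$ points generic for $\mu_2$, ..., and $m_k$ points generic for $\mu_k$. -/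

import Mathlib

open MeasureTheory Filter Topology
open SymbolicDynamics.FullShift

namespace FactorCode

noncomputable section

section Symbolic

variable {A B : Type*} [TopologicalSpace A] [TopologicalSpace B]

/-- The set of words (finite blocks of symbols) that occur in points of the shift space `X`. -/
def language (X : Subshift A ℤ) : Set (List A) :=
  {u | ∃ x ∈ X.carrier, ∃ i : ℤ, ∀ (j : ℕ) (hj : j < u.length), x (i + j) = u[j]}

/-- `X` is irreducible: any two words of `X` can be joined, in the given order, inside a word
of `X`. -/
def IsIrreducible (X : Subshift A ℤ) : Prop :=
  ∀ u ∈ language X, ∀ v ∈ language X, ∃ w : List A, u ++ w ++ v ∈ language X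

/-- `X` is a (two-sided) shift of finite type: it is given by finitely many forbidden patterns. -/
def IsSFT [Inhabited A] (X : Subshift A ℤ) : Prop :=
  ∃ F : Set (Pattern A ℤ), F.Finite ∧ X.carrier = forbidden F

/-- The left shift on a shift space. -/
def shiftMap (X : Subshift A ℤ) : X.carrier → X.carrier :=
  fun x => ⟨shift 1 (x : ℤ → A), X.mapsTo 1 x.2⟩

/-- A factor code: a continuous surjection between shift spaces that commutes with the shifts. -/
structure IsFactorCode (X : Subshift A ℤ) (Y : Subshift B ℤ) (π : X.carrier → Y.carrier) :
    Prop where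
  continuous : Continuous π
  surjective : Function.Surjective π
  commutes : ∀ x, π (shiftMap X x) = shiftMap Y (π x)

/-- A sofic shift: the image of a shift of finite type (over a finite alphabet, which may be
taken to be `{0, …, n}`) under a factor code. -/
def IsSofic (X : Subshift A ℤ) : Prop :=
  ∃ (n : ℕ) (Z : Subshift (Fin (n + 1)) ℤ) (φ : Z.carrier → X.carrier),
    IsSFT Z ∧ IsFactorCode Z X φ

/-- The map `π` is finite-to-one: each of its fibers is finite. -/
def IsFiniteToOne {X : Subshift A ℤ} {Y : Subshift B ℤ} (π : X.carrier → Y.carrier) : Prop :=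
  ∀ y, (π ⁻¹' {y}).Finite

/-- `x` is a doubly transitive point of `X`: every word of `X` occurs in `x` infinitely often to
the right and infinitely often to the left. -/
def IsDoublyTransitive (X : Subshift A ℤ) (x : X.carrier) : Prop :=
  ∀ u ∈ language X, ∀ N : ℤ,
    (∃ i ≥ N, ∀ (j : ℕ) (hj : j < u.length), x.1 (i + j) = u[j]) ∧
    (∃ i ≤ N, ∀ (j : ℕ) (hj : j < u.length), x.1 (i + j) = u[j])

open Classical in
/-- The degree of `π : X → Y`: the number `d` such that each doubly transitive point of `Y` has
exactly `d` preimages (`0` by convention if there is no such `d`). -/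
def degree {X : Subshift A ℤ} {Y : Subshift B ℤ} (π : X.carrier → Y.carrier) : ℕ :=
  if h : ∃ d : ℕ, ∀ y : Y.carrier, IsDoublyTransitive Y y → (π ⁻¹' {y}).encard = d
  then h.choose else 0

end Symbolic

section Measures

variable {A B : Type*} [TopologicalSpace A] [MeasurableSpace A]
  [TopologicalSpace B] [MeasurableSpace B]

/-- The diagonal shift on the `n`-fold power `Xⁿ`. -/
def powShift (X : Subshift A ℤ) (n : ℕ) : (Fin n → X.carrier) → (Fin n → X.carrier) :=
  fun z i => shiftMap X (z i)

/-- The `i`-th margin of a measure on `Xⁿ`. -/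
def margin {X : Subshift A ℤ} {n : ℕ} (ρ : Measure (Fin n → X.carrier)) (i : Fin n) :
    Measure X.carrier :=
  ρ.map (fun z => z i)

/-- `ρ` is an `n`-fold `π`-relative joining over `ν`: a shift-invariant probability measure on
`Xⁿ` that gives full measure to the set of tuples whose entries have a common `π`-image, and each
margin of which is mapped to `ν` by `π`. -/
structure IsRelativeJoining {X : Subshift A ℤ} {Y : Subshift B ℤ} (π : X.carrier → Y.carrier)
    (ν : Measure Y.carrier) {n : ℕ} (ρ : Measure (Fin n → X.carrier)) : Prop where
  prob : IsProbabilityMeasure ρ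
  invariant : MeasurePreserving (powShift X n) ρ ρ
  common_image : ∀ᵐ z ∂ρ, ∀ i j, π (z i) = π (z j)
  image_eq : ∀ i, (margin ρ i).map π = ν

/-- A measure on `Xⁿ` is separating if almost every tuple consists of `n` distinct points. -/
def IsSeparating {X : Subshift A ℤ} {n : ℕ} (ρ : Measure (Fin n → X.carrier)) : Prop :=
  ∀ᵐ z ∂ρ, Function.Injective z

/-- A degree joining over `ν`: an ergodic separating `d`-fold relative joining over `ν`, where
`d` is the degree of `π`. -/
structure IsDegreeJoining {X : Subshift A ℤ} {Y : Subshift B ℤ} (π : X.carrier → Y.carrier)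
    (ν : Measure Y.carrier) (ρ : Measure (Fin (degree π) → X.carrier)) : Prop where
  joining : IsRelativeJoining π ν ρ
  ergodic : Ergodic (powShift X (degree π)) ρ
  separating : IsSeparating ρ

/-- The number of times that `μ` appears as a margin of `ρ`. -/
def marginCount {X : Subshift A ℤ} {n : ℕ} (ρ : Measure (Fin n → X.carrier))
    (μ : Measure X.carrier) : ℕ :=
  Nat.card {i : Fin n // margin ρ i = μ}

open Classical in
/-- The multiplicity of `μ` with respect to `π`: the number of times that `μ` appears as a margin
in a degree joining over the image of `μ` (`0` by convention if there is no degree joining). -/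
def multiplicity {X : Subshift A ℤ} {Y : Subshift B ℤ} (π : X.carrier → Y.carrier)
    (μ : Measure X.carrier) : ℕ :=
  if h : ∃ ρ : Measure (Fin (degree π) → X.carrier), IsDegreeJoining π (μ.map π) ρ
  then marginCount h.choose μ else 0

/-- `μ` is an ergodic lift of `ν`: an ergodic shift-invariant probability measure on `X` whose
image under `π` is `ν`. -/
structure IsErgodicLift {X : Subshift A ℤ} {Y : Subshift B ℤ} (π : X.carrier → Y.carrier)
    (ν : Measure Y.carrier) (μ : Measure X.carrier) : Prop where
  prob : IsProbabilityMeasure μ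
  ergodic : Ergodic (shiftMap X) μ
  map_eq : μ.map π = ν

/-- `x` is generic for `μ`: for every continuous real function on `X`, the averages along the
forward orbit of `x` converge to the `μ`-integral. -/
def IsGeneric {X : Subshift A ℤ} (x : X.carrier) (μ : Measure X.carrier) : Prop :=
  ∀ f : X.carrier → ℝ, Continuous f →
    Tendsto (fun n => birkhoffAverage ℝ (shiftMap X) f n x) atTop (𝓝 (∫ z, f z ∂μ))

end Measures

end

end FactorCode

/-!
Almost every point of `Y` is doubly transitive, because `ν` is ergodic and fully supported, so
almost every fiber of `π` has exactly `d = degree π` points. A degree joining `ρ` lives on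
injective `d`-tuples inside a fiber, hence on enumerations of fibers. Its margins are ergodic lifts
of `ν`, so by the pointwise ergodic theorem the `i`-th entry of almost every tuple is generic for
the `i`-th margin. Thus almost every fiber consists of points generic for margins of `ρ`, and the
number of its points generic for `μ` is the number of margins equal to `μ`
(`IsDegreeJoining.ae_encard_generic`). Since a point is generic for at most one measure, every
ergodic lift is a margin of `ρ`, there are at most `d` of them, and the multiplicities, being read
off from the fibers, do not depend on `ρ`. Three facts carry this argument.

* The degree exists (`exists_encard_fiber_eq`). The follower sets of `X` are finite in number and
  yield the Fischer cover, a finite-to-one cover of `X` by an irreducible Markov shift `Z`. For a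
  finite-to-one one-block code on `Z` a magic window is a window of labels that admits the least
  possible number of symbols at its centre. Between two occurrences of a magic window, a chain is
  determined by the symbol at either end: two chains that agree at one end extend, by concatenation,
  to chains over one periodic label sequence; there are only finitely many chains over it, so all
  of them are periodic, and splicing two of them at a common symbol shows that they are equal
  (`eq_of_periodic_label`, `IsMagic.eqOn`). Hence the number of chains over a label sequence in
  which the magic window recurs is the number of symbols at its centre. This applies to `Z → Y` over
  doubly transitive points, and to `Z → X` over all of their preimages: by irreducibility all
  symbols at the centre of a magic window can be steered through any prescribed window by a single
  label sequence (`IsMagic.exists_steering`), so the chains over a doubly transitive point recur.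
* There is a degree joining (`exists_isDegreeJoining`). Integrating the counting measures on the
  `d`-tuples within the fibers gives a finite invariant measure, for which the mass of an invariant
  set is an integer by the ergodicity of `ν`; the normalised restriction to an invariant set of
  injective tuples of least positive mass is ergodic, so no ergodic decomposition is needed
  (`exists_ergodic_lift_of_finite_fibers`).
* Birkhoff's pointwise ergodic theorem for ergodic measures (`ae_tendsto_birkhoffAverage`) is
  obtained from the maximal ergodic theorem.
-/

namespace FactorCode

/-! ### Chains of a finite relation and their labels -/

section Markov

variable {E C : Type*}

/-- The vertex shift of the relation `R`: the bi-infinite sequences whose consecutive entries are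
`R`-related. -/
def chains (R : E → E → Prop) : Set (ℤ → E) := {z | ∀ i, R (z i) (z (i + 1))}

/-- Compactness of `ℤ → E` for finite `E`: every sequence has a limit point, in the product of the
discrete topologies. -/
lemma exists_limit_of_seq [Finite E] (z : ℕ → ℤ → E) :
    ∃ z' : ℤ → E, ∀ n : ℕ, ∃ m ≥ n, Set.EqOn z' (z m) (Set.Icc (-n : ℤ) n) := by
  -- The limit along a nonprincipal ultrafilter exists coordinatewise, as `E` is finite.
  have key : ∀ i : ℤ, ∃ e : E, ∀ᶠ m in (hyperfilter ℕ : Filter ℕ), z m i = e := by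
    intro i
    have : (⋃ e ∈ (Set.univ : Set E), {m | z m i = e}) = Set.univ := by
      ext m; simp
    obtain ⟨e, -, he⟩ := (Ultrafilter.finite_biUnion_mem_iff (Set.finite_univ (α := E))).1
      (this ▸ Filter.univ_mem : (⋃ e ∈ (Set.univ : Set E), {m | z m i = e}) ∈ hyperfilter ℕ)
    exact ⟨e, he⟩
  choose z' hz' using key
  refine ⟨z', fun n => ?_⟩
  have h1 : ∀ᶠ m in (hyperfilter ℕ : Filter ℕ), ∀ i ∈ Set.Icc (-n : ℤ) n, z m i = z' i :=
    (eventually_all_finite (Set.finite_Icc _ _)).2 fun i _ => hz' i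
  have h2 : ∀ᶠ m in (hyperfilter ℕ : Filter ℕ), n ≤ m :=
    Nat.hyperfilter_le_atTop (eventually_ge_atTop n)
  obtain ⟨m, hm1, hm2⟩ := (h1.and h2).exists
  exact ⟨m, hm2, fun i hi => (hm1 i hi).symm⟩

/-- If every element has an `r`-successor and an `r`-predecessor, then every element lies on a
bi-infinite `r`-orbit. -/
lemma exists_int_orbit {α : Type*} {r : α → α → Prop} (hr : ∀ a, ∃ b, r a b)
    (hl : ∀ b, ∃ a, r a b) (a : α) : ∃ p : ℤ → α, p 0 = a ∧ ∀ k, r (p k) (p (k + 1)) := by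
  choose nx hnx using hr
  choose pv hpv using hl
  refine ⟨fun k => match k with
    | Int.ofNat n => nx^[n] a
    | Int.negSucc n => pv^[n + 1] a, rfl, ?_⟩
  rintro (n | n)
  · have : (Int.ofNat n + 1) = Int.ofNat (n + 1) := rfl
    simp only [this, Function.iterate_succ_apply']
    exact hnx _
  · cases n with
    | zero => exact hpv a
    | succ n =>
      have : (Int.negSucc (n + 1) + 1) = Int.negSucc n := by simp [Int.negSucc_eq]
      simp only [this]
      rw [Function.iterate_succ_apply' _ (n + 1)]
      exact hpv _

variable {R : E → E → Prop}

lemma shift_mem_chains {z : ℤ → E} (hz : z ∈ chains R) (k : ℤ) :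
    (fun i => z (i + k)) ∈ chains R := by
  intro i
  have := hz (i + k)
  simpa [add_right_comm] using this

/-- Two chains that agree at the time `k` can be spliced there. -/
lemma splice_mem_chains {z z' : ℤ → E} (hz : z ∈ chains R) (hz' : z' ∈ chains R) {k : ℤ}
    (h : z k = z' k) : (fun i => if i ≤ k then z i else z' i) ∈ chains R := by
  intro i
  rcases lt_trichotomy i k with hi | rfl | hi
  · simpa [hi.le, Int.add_one_le_iff.2 hi] using hz i
  · simpa [h] using hz' i
  · simpa [not_le.2 hi, not_le.2 (hi.trans (lt_add_one i))] using hz' i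

/-- Pieces `p k` over `[s, s + T]` with matching ends concatenate to a chain, the `k`-th piece being
placed over `[kT, (k + 1)T]`. -/
lemma exists_concat {T : ℤ} (hT : 0 < T) {s : ℤ} {p : ℤ → ℤ → E} (hp : ∀ k, p k ∈ chains R)
    (hpp : ∀ k, p k (s + T) = p (k + 1) s) :
    ∃ z ∈ chains R, (∀ i, z i = p (i / T) (s + i % T)) ∧
      ∀ i ∈ Set.Icc 0 T, z i = p 0 (s + i) := by
  have hlt : ∀ i, 0 ≤ i → i < T → i / T = 0 ∧ i % T = i := fun i h0 h1 =>
    ⟨Int.ediv_eq_zero_of_lt h0 h1, Int.emod_eq_of_lt h0 h1⟩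
  refine ⟨fun i => p (i / T) (s + i % T), fun i => ?_, fun i => rfl, fun i hi => ?_⟩
  · have h0 := Int.emod_nonneg i hT.ne'
    have h1 := Int.emod_lt_of_pos i hT
    have h2 := Int.mul_ediv_add_emod i T
    rcases (Int.add_one_le_iff.2 h1).lt_or_eq with h | h
    · have e := (Int.ediv_emod_unique (a := i + 1) (q := i / T) (r := i % T + 1) hT).2
        ⟨by linarith, by linarith, h⟩
      simp only [e.1, e.2]
      rw [← add_assoc]
      exact hp _ _
    · have e := (Int.ediv_emod_unique (a := i + 1) (q := i / T + 1) (r := 0) hT).2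
        ⟨by linarith, le_rfl, hT⟩
      simp only [e.1, e.2, add_zero]
      have e' : s + T = s + i % T + 1 := by rw [add_assoc, h]
      rw [← hpp, e']
      exact hp _ _
  · rcases hi.2.lt_or_eq with h | rfl
    · simp [hlt i hi.1 h]
    · simp [Int.ediv_self hT.ne', hpp]

/-- Two chains over the same periodic label sequence that share a symbol coincide. -/
lemma eq_of_periodic_label {f : E → C} (hfin : ∀ y : ℤ → C, {z ∈ chains R | f ∘ z = y}.Finite)
    {y : ℤ → C} {T : ℤ} (hT : 0 < T) (hy : ∀ i, y (i + T) = y i) {z z' : ℤ → E}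
    (hz : z ∈ chains R) (hzy : f ∘ z = y) (hz' : z' ∈ chains R) (hzy' : f ∘ z' = y)
    {k : ℤ} (hk : z k = z' k) : z = z' := by
  have hy' : ∀ (n : ℕ) i, y (i + n * T) = y i := by
    intro n
    induction n with
    | zero => simp
    | succ n ih =>
      intro i
      rw [← ih i, ← hy (i + n * T)]
      congr 1; push_cast; ring
  -- Shifting by multiples of `T` stays within a finite fiber, so each chain over `y` is periodic.
  have per : ∀ z ∈ chains R, f ∘ z = y → ∃ M : ℤ, 0 < M ∧ ∀ (m : ℕ) i, z (i + m * M) = z i := by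
    intro z hz hzy
    have hmem : ∀ n : ℕ, (fun i => z (i + n * T)) ∈ {z ∈ chains R | f ∘ z = y} := fun n =>
      ⟨shift_mem_chains hz _, by
        ext i
        have := hy' n i
        rw [← hzy] at this ⊢
        exact this⟩
    obtain ⟨a, b, hab, h⟩ := (hfin y).exists_lt_map_eq_of_forall_mem hmem
    refine ⟨(b - a) * T, mul_pos (sub_pos.2 (Nat.cast_lt.2 hab)) hT, ?_⟩
    have h1 : ∀ i, z (i + (b - a) * T) = z i := by
      intro i
      have := congrFun h (i - a * T)
      simp only [sub_add_cancel] at this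
      rw [this]; congr 1; ring
    intro m
    induction m with
    | zero => simp
    | succ n ih =>
      intro i
      rw [← ih i, ← h1 (i + n * _)]
      congr 1; push_cast; ring
  set r : ℤ → E := fun i => if i ≤ k then z i else z' i with hr
  have hrm : r ∈ chains R := splice_mem_chains hz hz' hk
  have hry : f ∘ r = y := by
    ext i
    by_cases h : i ≤ k
    · simp [hr, h, ← hzy]
    · simp [hr, h, ← hzy']
  obtain ⟨M, hM, hMr⟩ := per r hrm hry
  -- The splice `r` is periodic too, so it equals every chain over `y` that it agrees with
  -- on a half-line.
  have comm : ∀ z ∈ chains R, f ∘ z = y → (∃ N, (∀ i ≤ N, r i = z i) ∨ (∀ i ≥ N, r i = z i)) →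
      r = z := by
    intro z hz hzy ⟨N, hN⟩
    obtain ⟨L, hL, hLz⟩ := per z hz hzy
    ext i
    obtain ⟨m, hm⟩ : ∃ m : ℕ, |i - N| ≤ m := ⟨(i - N).natAbs, by simp⟩
    lift L to ℕ using hL.le
    lift M to ℕ using hM.le
    have hLM : (1 : ℤ) ≤ L * M := by exact_mod_cast mul_pos hL hM
    have hm' := abs_le.1 hm
    have hmm : (m : ℤ) ≤ m * (L * M) := by nlinarith
    rcases hN with hN | hN
    · have h1 := hMr (m * L) (i - m * (L * M))
      have h2 := hLz (m * M) (i - m * (L * M))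
      have h3 := hN (i - m * (L * M)) (by linarith)
      have e1 : i - m * (L * M) + ((m * L : ℕ) : ℤ) * M = i := by push_cast; ring
      have e2 : i - m * (L * M) + ((m * M : ℕ) : ℤ) * L = i := by push_cast; ring
      rw [e1] at h1; rw [e2] at h2
      rw [h1, h2, h3]
    · have h1 := hMr (m * L) i
      have h2 := hLz (m * M) i
      have h3 := hN (i + m * (L * M)) (by linarith)
      have e1 : i + ((m * L : ℕ) : ℤ) * M = i + m * (L * M) := by push_cast; ring
      have e2 : i + ((m * M : ℕ) : ℤ) * L = i + m * (L * M) := by push_cast; ring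
      rw [e1] at h1; rw [e2] at h2
      rw [← h1, ← h2, h3]
  rw [← comm z hz hzy ⟨k, .inl fun i hi => by simp [hr, hi]⟩,
    ← comm z' hz' hzy' ⟨k + 1, .inr fun i hi => by
      have : ¬ i ≤ k := by omega
      simp [hr, this]⟩]

end Markov

/-! ### Magic windows -/

section Magic

variable {E C : Type*}

/-- The central window of radius `n` of the sequence `w` occurs in `y` around the time `s`. -/
def OccursAt (n : ℕ) (w y : ℤ → C) (s : ℤ) : Prop :=
  ∀ j ∈ Set.Icc (-n : ℤ) n, y (s + j) = w j

/-- The central window of radius `n` of `w` occurs in `y` infinitely often in both directions. -/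
def Recurs (n : ℕ) (w y : ℤ → C) : Prop :=
  ∀ N : ℤ, (∃ s ≥ N, OccursAt n w y s) ∧ ∃ s ≤ N, OccursAt n w y s

/-- The symbols seen at time `0` among the chains whose labels agree with `w` on `[-n, n]`. -/
def windowSet (R : E → E → Prop) (f : E → C) (w : ℤ → C) (n : ℕ) : Set E :=
  {e | ∃ z ∈ chains R, z 0 = e ∧ OccursAt n w (f ∘ z) 0}

/-- The window of radius `n` of the label sequence `w` is magic: it is realised by a chain and
the number of symbols that chains over it can show at its centre is the least possible. -/
structure IsMagic (R : E → E → Prop) (f : E → C) (w : ℤ → C) (n : ℕ) : Prop where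
  exists_chain : ∃ z ∈ chains R, f ∘ z = w
  le_ncard : ∀ z ∈ chains R, ∀ m, (windowSet R f w n).ncard ≤ (windowSet R f (f ∘ z) m).ncard

variable {R : E → E → Prop} {f : E → C} {w : ℤ → C} {n : ℕ}

lemma exists_isMagic (hne : (chains R).Nonempty) :
    ∃ w n, IsMagic R f w n := by
  obtain ⟨z₀, hz₀⟩ := hne
  obtain ⟨⟨⟨z, hz⟩, n⟩, -, h⟩ := WellFounded.has_min
    (measure fun p : chains R × ℕ => (windowSet R f (f ∘ p.1.1) p.2).ncard).wf Set.univ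
    ⟨(⟨z₀, hz₀⟩, 0), trivial⟩
  exact ⟨f ∘ z, n, ⟨z, hz, rfl⟩, fun z' hz' m => not_lt.1 (h (⟨z', hz'⟩, m) trivial)⟩

lemma mem_windowSet {z : ℤ → E} (hz : z ∈ chains R) {s : ℤ} (h : OccursAt n w (f ∘ z) s) :
    z s ∈ windowSet R f w n :=
  ⟨fun i => z (i + s), shift_mem_chains hz s, by simp, fun j hj => by
    have := h j hj
    simpa [add_comm] using this⟩

lemma windowSet_nonempty (h : IsMagic R f w n) : (windowSet R f w n).Nonempty := by
  obtain ⟨z, hz, rfl⟩ := h.exists_chain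
  exact ⟨z 0, z, hz, rfl, fun j _ => by simp⟩

/-- Every symbol of a magic window set is realised by a chain following any prescribed longer
piece of label sequence around an occurrence of the magic window. -/
lemma IsMagic.exists_chain_of_occursAt [Finite E] (h : IsMagic R f w n) {z₀ : ℤ → E}
    (hz₀ : z₀ ∈ chains R) {s : ℤ} (hs : OccursAt n w (f ∘ z₀) s) {e : E}
    (he : e ∈ windowSet R f w n) (l r : ℤ) :
    ∃ z ∈ chains R, z s = e ∧ ∀ i ∈ Set.Icc l r, f (z i) = f (z₀ i) := by
  obtain ⟨m, hm⟩ : ∃ m : ℕ, n ≤ m ∧ s - m ≤ l ∧ r ≤ s + m :=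
    ⟨n + (s - l).natAbs + (r - s).natAbs, by omega, by omega, by omega⟩
  set y : ℤ → E := fun i => z₀ (i + s) with hy
  -- A longer window restricts the centre further, but by minimality not strictly.
  have hsub : windowSet R f (f ∘ y) m ⊆ windowSet R f w n := by
    rintro _ ⟨z, hz, rfl, hzy⟩
    refine ⟨z, hz, rfl, fun j hj => ?_⟩
    have h1 := hzy j ⟨by linarith [hj.1, (Nat.cast_le (α := ℤ)).2 hm.1],
      by linarith [hj.2, (Nat.cast_le (α := ℤ)).2 hm.1]⟩
    rw [h1, ← hs j hj]
    simp [hy, add_comm]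
  have heq := Set.eq_of_subset_of_ncard_le hsub (h.le_ncard y (shift_mem_chains hz₀ s) m)
    (Set.toFinite _)
  rw [← heq] at he
  obtain ⟨z, hz, hze, hzy⟩ := he
  refine ⟨fun i => z (i + -s), shift_mem_chains hz _, by simpa using hze, fun i hi => ?_⟩
  have := hzy (i - s) ⟨by linarith [hi.1, hm.2.1], by linarith [hi.2, hm.2.2]⟩
  simpa [hy, sub_eq_add_neg] using this

/-- Between two occurrences of a magic window, a chain over a given label sequence is determined
by the symbol it shows at either of them. -/
lemma IsMagic.eqOn [Finite E] (h : IsMagic R f w n)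
    (hfin : ∀ y : ℤ → C, {z ∈ chains R | f ∘ z = y}.Finite) {z₀ z z' : ℤ → E} {s t : ℤ}
    (hz₀ : z₀ ∈ chains R) (hz : z ∈ chains R) (hz' : z' ∈ chains R) (hst : s < t)
    (hs : OccursAt n w (f ∘ z₀) s) (ht : OccursAt n w (f ∘ z₀) t)
    (hl : ∀ i ∈ Set.Icc (s - n) (t + n), f (z i) = f (z₀ i))
    (hl' : ∀ i ∈ Set.Icc (s - n) (t + n), f (z' i) = f (z₀ i))
    (heq : z s = z' s ∨ z t = z' t) : Set.EqOn z z' (Set.Icc s t) := by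
  obtain ⟨T, hT, rfl⟩ : ∃ T, 0 < T ∧ t = s + T := ⟨t - s, by omega, by omega⟩
  -- Every such piece can be followed and preceded by another one, by minimality, and so extends
  -- to a chain with the periodic label sequence that repeats `f ∘ z₀` on `[s, t)`.
  let α := {z : ℤ → E // z ∈ chains R ∧
    ∀ i ∈ Set.Icc (s - n) (s + T + n), f (z i) = f (z₀ i)}
  have occ : ∀ a : α, ∀ u ∈ Set.Icc s (s + T), OccursAt n w (f ∘ z₀) u →
      OccursAt n w (f ∘ a.1) u := fun a u hu ho j hj => by
    rw [← ho j hj]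
    exact a.2.2 _ ⟨by linarith [hu.1, hj.1], by linarith [hu.2, hj.2]⟩
  have hr : ∀ a : α, ∃ b : α, a.1 (s + T) = b.1 s := fun a => by
    obtain ⟨b, hb, hbe, hbl⟩ := h.exists_chain_of_occursAt hz₀ hs
      (mem_windowSet a.2.1 (occ a (s + T) ⟨by linarith, le_rfl⟩ ht)) (s - n) (s + T + n)
    exact ⟨⟨b, hb, hbl⟩, hbe.symm⟩
  have hl : ∀ b : α, ∃ a : α, a.1 (s + T) = b.1 s := fun b => by
    obtain ⟨a, ha, hae, hal⟩ := h.exists_chain_of_occursAt hz₀ ht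
      (mem_windowSet b.2.1 (occ b s ⟨le_rfl, by linarith⟩ hs)) (s - n) (s + T + n)
    exact ⟨⟨a, ha, hal⟩, hae⟩
  have ext : ∀ a : α, ∃ ζ ∈ chains R, (∀ i ∈ Set.Icc 0 T, ζ i = a.1 (s + i)) ∧
      f ∘ ζ = fun i => f (z₀ (s + i % T)) := fun a => by
    obtain ⟨p, hp0, hp⟩ := exists_int_orbit hr hl a
    obtain ⟨ζ, hζ, h1, h2⟩ := exists_concat hT (p := fun k => (p k).1) (fun k => (p k).2.1) hp
    refine ⟨ζ, hζ, fun i hi => by rw [h2 i hi, hp0], ?_⟩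
    ext i
    have h3 := Int.emod_nonneg i hT.ne'
    have h4 := Int.emod_lt_of_pos i hT
    simp only [Function.comp, h1]
    exact (p (i / T)).2.2 _ ⟨by linarith, by linarith⟩
  obtain ⟨ζ, hζ, h1, h2⟩ := ext ⟨z, hz, ‹_›⟩
  obtain ⟨ζ', hζ', h1', h2'⟩ := ext ⟨z', hz', hl'⟩
  have : ∃ k, ζ k = ζ' k := by
    rcases heq with heq | heq
    · exact ⟨0, by simpa [h1 0 ⟨le_rfl, hT.le⟩, h1' 0 ⟨le_rfl, hT.le⟩] using heq⟩
    · exact ⟨T, by simpa [h1 T ⟨hT.le, le_rfl⟩, h1' T ⟨hT.le, le_rfl⟩] using heq⟩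
  obtain ⟨k, hk⟩ := this
  have := eq_of_periodic_label hfin hT (fun i => by simp) hζ h2 hζ' h2' hk
  intro i hi
  have hi' : i - s ∈ Set.Icc 0 T := ⟨by linarith [hi.1], by linarith [hi.2]⟩
  have e1 := h1 _ hi'
  have e2 := h1' _ hi'
  simp only [add_sub_cancel] at e1 e2
  rw [← e1, ← e2, this]

/-- A label sequence in which a magic window recurs has as many chains over it as there are
symbols at the centre of the magic window. -/
lemma IsMagic.encard_fiber [Finite E] (h : IsMagic R f w n)
    (hfin : ∀ y : ℤ → C, {z ∈ chains R | f ∘ z = y}.Finite) {z₀ : ℤ → E}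
    (hz₀ : z₀ ∈ chains R) (hrec : Recurs n w (f ∘ z₀)) :
    {z ∈ chains R | f ∘ z = f ∘ z₀}.encard = (windowSet R f w n).encard := by
  obtain ⟨s, -, hs⟩ := (hrec 0).1
  have hbij : Set.BijOn (fun z : ℤ → E => z s) {z ∈ chains R | f ∘ z = f ∘ z₀}
      (windowSet R f w n) := ?_
  · rw [← hbij.image_eq, hbij.injOn.encard_image]
  refine ⟨?_, ?_, ?_⟩
  · rintro z ⟨hz, hzy⟩
    exact mem_windowSet hz (hzy ▸ hs)
  · rintro z ⟨hz, hzy⟩ z' ⟨hz', hzy'⟩ heq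
    have hl : ∀ i, f (z i) = f (z₀ i) := congrFun hzy
    have hl' : ∀ i, f (z' i) = f (z₀ i) := congrFun hzy'
    ext i
    rcases le_or_gt s i with hi | hi
    · obtain ⟨t, ht, ht'⟩ := (hrec (i + 1)).1
      exact h.eqOn hfin hz₀ hz hz' (by omega) hs ht' (fun i _ => hl i) (fun i _ => hl' i)
        (.inl heq) ⟨hi, by omega⟩
    · obtain ⟨t, ht, ht'⟩ := (hrec i).2
      exact h.eqOn hfin hz₀ hz hz' (by omega) ht' hs (fun i _ => hl i) (fun i _ => hl' i)
        (.inr heq) ⟨ht, by omega⟩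
  · intro e he
    choose z hz hze hzl using fun m : ℕ =>
      h.exists_chain_of_occursAt hz₀ hs he (-m) m
    obtain ⟨z', hz'⟩ := exists_limit_of_seq z
    refine ⟨z', ⟨fun i => ?_, ?_⟩, ?_⟩
    · obtain ⟨m, -, hm⟩ := hz' (i.natAbs + 1)
      rw [hm ⟨by omega, by omega⟩, hm ⟨by omega, by omega⟩]
      exact hz m i
    · ext i
      obtain ⟨m, hm', hm⟩ := hz' i.natAbs
      simp only [Function.comp]
      rw [hm ⟨by omega, by omega⟩]
      exact hzl m i ⟨by omega, by omega⟩
    · obtain ⟨m, -, hm⟩ := hz' s.natAbs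
      simp only
      rw [hm ⟨by omega, by omega⟩, hze]

/-- In an irreducible Markov shift, any symbols of a magic window set can be steered through a
given window of the chain `u`, all by one label sequence. -/
lemma IsMagic.exists_steering [Finite E] (h : IsMagic R f w n)
    (hfin : ∀ y : ℤ → C, {z ∈ chains R | f ∘ z = y}.Finite)
    (hirr : ∀ z ∈ chains R, ∀ z' ∈ chains R, ∃ m : ℕ, ∃ z'' ∈ chains R,
      (∀ i ≤ 0, z'' i = z i) ∧ ∀ i ≥ 0, z'' (i + m) = z' i)
    {u : ℤ → E} (hu : u ∈ chains R) (k : ℕ) {S : Set E} (hSf : S.Finite)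
    (hS : S ⊆ windowSet R f w n) :
    ∃ z₀ ∈ chains R, ∃ t : ℤ, 0 ≤ t ∧ OccursAt n w (f ∘ z₀) 0 ∧ OccursAt n w (f ∘ z₀) t ∧
      ∀ z ∈ chains R, (∀ i ∈ Set.Icc (-n : ℤ) (t + n), f (z i) = f (z₀ i)) → z 0 ∈ S →
        ∃ s ∈ Set.Icc 0 t, OccursAt k u z s := by
  have join : ∀ z ∈ chains R, ∀ z' ∈ chains R, ∀ a b : ℤ, ∃ m : ℤ, a ≤ m + b ∧ ∃ z'' ∈ chains R,
      (∀ i ≤ a, z'' i = z i) ∧ ∀ i ≥ b, z'' (i + m) = z' i := by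
    intro z hz z' hz' a b
    obtain ⟨m, z'', hz'', h1, h2⟩ := hirr _ (shift_mem_chains hz a) _ (shift_mem_chains hz' b)
    refine ⟨m + a - b, by omega, _, shift_mem_chains hz'' (-a), fun i hi => ?_, fun i hi => ?_⟩
    · have := h1 (i + -a) (by omega)
      simpa using this
    · have := h2 (i - b) (by omega)
      simp only [sub_add_cancel] at this
      rw [← this]; congr 1; ring
  induction S, hSf using Set.Finite.induction_on with
  | empty =>
    obtain ⟨z, hz, rfl⟩ := h.exists_chain
    refine ⟨z, hz, 0, le_rfl, ?_, ?_, by simp⟩ <;> intro j _ <;> simp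
  | @insert e S _ _ ih =>
    -- Follow the chain `z` from `e` through the steering sequence for `S`, then pass through the
    -- window of `u`, then return to the magic window.
    obtain ⟨z₀, hz₀, t, ht, h0, h1, h2⟩ := ih fun x hx => hS (Set.mem_insert_of_mem _ hx)
    obtain ⟨zm, hzm, hzmw⟩ := h.exists_chain
    obtain ⟨z, hz, hze, hzl⟩ := h.exists_chain_of_occursAt hz₀ h0 (hS (Set.mem_insert _ _))
      (-n) (t + n)
    obtain ⟨m₁, hm₁, z₁, hz₁, h11, h12⟩ := join z hz u hu (t + n + 1) (-k)
    obtain ⟨m₂, hm₂, z₂, hz₂, h21, h22⟩ := join z₁ hz₁ zm hzm (m₁ + k) (-n)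
    have e1 : ∀ i ≤ t + n, z₂ i = z i := fun i hi => by
      rw [h21 i (by omega), h11 i (by omega)]
    have e2 : OccursAt k u z₂ m₁ := fun j hj => by
      rw [h21 _ (by linarith [hj.2]), add_comm, h12 _ hj.1]
    have e3 : OccursAt n w (f ∘ z₂) m₂ := fun j hj => by
      rw [← hzmw]
      simp only [Function.comp]
      rw [add_comm, h22 _ hj.1]
    have e0 : OccursAt n w (f ∘ z₂) 0 := fun j hj => by
      rw [← h0 j hj]
      simp only [Function.comp]
      rw [e1 _ (by linarith [hj.2]), hzl _ ⟨by linarith [hj.1], by linarith [hj.2]⟩]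
    refine ⟨z₂, hz₂, m₂, by omega, e0, e3, fun z' hz' hl hzS => ?_⟩
    rcases hzS with hzS | hzS
    · have := h.eqOn hfin hz₂ hz' hz₂ (show 0 < m₂ by omega) e0 e3 (by simpa using hl)
        (fun _ _ => rfl) (.inl (by rw [hzS, e1 _ (by omega), hze]))
      exact ⟨m₁, ⟨by omega, by omega⟩, fun j hj => by
        rw [this ⟨by linarith [hj.1], by linarith [hj.2]⟩, e2 j hj]⟩
    · obtain ⟨s, hs, hs'⟩ := h2 z' hz' (fun i hi => by
        rw [hl i ⟨hi.1, by linarith [hi.2]⟩, e1 i hi.2, hzl i hi]) hzS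
      exact ⟨s, ⟨hs.1, by linarith [hs.2]⟩, hs'⟩

/-- In an irreducible Markov shift, the recurrence of a suitable window of labels forces the
recurrence of a given window in the chain. -/
lemma exists_recurs_of_label_recurs [Finite E] (h : IsMagic R f w n)
    (hfin : ∀ y : ℤ → C, {z ∈ chains R | f ∘ z = y}.Finite)
    (hirr : ∀ z ∈ chains R, ∀ z' ∈ chains R, ∃ m : ℕ, ∃ z'' ∈ chains R,
      (∀ i ≤ 0, z'' i = z i) ∧ ∀ i ≥ 0, z'' (i + m) = z' i)
    {u : ℤ → E} (hu : u ∈ chains R) (k : ℕ) :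
    ∃ z₀ ∈ chains R, ∃ n' : ℕ, ∀ z ∈ chains R, Recurs n' (f ∘ z₀) (f ∘ z) → Recurs k u z := by
  obtain ⟨z₀, hz₀, t, ht, h0, -, h2⟩ := h.exists_steering hfin hirr hu k (Set.toFinite _)
    (subset_refl _)
  lift t to ℕ using ht
  have key : ∀ z ∈ chains R, ∀ s, OccursAt (t + n) (f ∘ z₀) (f ∘ z) s →
      ∃ r ∈ Set.Icc s (s + t), OccursAt k u z r := by
    intro z hz s hs
    have hl : ∀ i ∈ Set.Icc (-n : ℤ) (t + n), f (z (i + s)) = f (z₀ i) := fun i hi => by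
      have := hs i ⟨by push_cast; linarith [hi.1], by push_cast; linarith [hi.2]⟩
      rw [add_comm]; exact this
    obtain ⟨r, hr, hr'⟩ := h2 _ (shift_mem_chains hz s) hl
      (mem_windowSet (shift_mem_chains hz s) fun j hj => by
        rw [← h0 j hj]
        simp only [Function.comp, zero_add]
        exact hl j ⟨hj.1, by linarith [hj.2]⟩)
    refine ⟨r + s, ⟨by linarith [hr.1], by linarith [hr.2]⟩, fun j hj => ?_⟩
    rw [← hr' j hj]
    congr 1; ring
  refine ⟨z₀, hz₀, t + n, fun z hz hrec N => ⟨?_, ?_⟩⟩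
  · obtain ⟨s, hs, hs'⟩ := (hrec N).1
    obtain ⟨r, hr, hr'⟩ := key z hz s hs'
    exact ⟨r, hs.trans hr.1, hr'⟩
  · obtain ⟨s, hs, hs'⟩ := (hrec (N - t)).2
    obtain ⟨r, hr, hr'⟩ := key z hz s hs'
    exact ⟨r, by linarith [hr.2], hr'⟩

end Magic

/-! ### Words and follower sets -/

section Words

variable {A : Type*}

/-- The word `u` is read in `x` from the position `i` on. -/
def Reads (x : ℤ → A) (i : ℤ) (u : List A) : Prop :=
  ∀ (j : ℕ) (hj : j < u.length), x (i + j) = u[j]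

@[simp] lemma reads_nil (x : ℤ → A) (i : ℤ) : Reads x i [] := fun _ hj => by simp at hj

lemma reads_cons {x : ℤ → A} {i : ℤ} {a : A} {u : List A} :
    Reads x i (a :: u) ↔ x i = a ∧ Reads x (i + 1) u := by
  constructor
  · intro h
    have e : x (i + (0 : ℕ)) = a := h 0 (by simp)
    refine ⟨by simpa using e, fun j hj => ?_⟩
    have := h (j + 1) (by simpa using hj)
    rw [add_assoc, add_comm 1]
    simpa using this
  · rintro ⟨rfl, h⟩ (_ | j) hj
    · simp
    · have := h j (by simpa using hj)
      rw [add_assoc, add_comm 1] at this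
      simpa using this

lemma reads_append {x : ℤ → A} {i : ℤ} {u v : List A} :
    Reads x i (u ++ v) ↔ Reads x i u ∧ Reads x (i + u.length) v := by
  induction u generalizing i with
  | nil => simp
  | cons a u ih =>
    simp only [List.cons_append, reads_cons, ih, List.length_cons, and_assoc, Nat.cast_add,
      Nat.cast_one]
    rw [add_assoc, add_comm 1]

lemma reads_ofFn (x : ℤ → A) (i : ℤ) (n : ℕ) :
    Reads x i (List.ofFn fun j : Fin n => x (i + j)) := fun j hj => by simp

lemma reads_shift {x : ℤ → A} {i k : ℤ} {u : List A} :
    Reads (shift k x) i u ↔ Reads x (k + i) u := by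
  simp [Reads, add_assoc]

variable [TopologicalSpace A] {X : Subshift A ℤ}

lemma isOpen_setOf_reads [DiscreteTopology A] (i : ℤ) (u : List A) :
    IsOpen {y : X.carrier | Reads y.1 i u} := by
  have : {y : X.carrier | Reads y.1 i u} =
      ⋂ j : Fin u.length, {y : X.carrier | y.1 (i + (j : ℕ)) = u[j]} := by
    ext y
    simp only [Set.mem_ofPred_eq, Set.mem_iInter, Reads]
    exact ⟨fun h j => h j j.2, fun h j hj => h ⟨j, hj⟩⟩
  rw [this]
  refine isOpen_iInter_of_finite fun j => ?_
  have hc : Continuous fun y : X.carrier => y.1 (i + (j : ℕ)) :=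
    (continuous_apply _).comp continuous_subtype_val
  exact (isOpen_discrete {u[j]}).preimage hc

lemma mem_language_at {u : List A} (h : u ∈ language X) (i : ℤ) :
    ∃ x ∈ X.carrier, Reads x i u := by
  obtain ⟨x, hx, k, hk⟩ := h
  refine ⟨shift (k - i) x, X.mapsTo _ hx, reads_shift.2 (by rw [sub_add_cancel]; exact hk)⟩

lemma language_infix {u v w : List A} (h : u ++ v ++ w ∈ language X) : v ∈ language X := by
  obtain ⟨x, hx, i, hi⟩ := h
  exact ⟨x, hx, _, (reads_append.1 (reads_append.1 hi).1).2⟩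

lemma language_left {u v : List A} (h : u ++ v ∈ language X) : u ∈ language X :=
  language_infix (u := []) (by simpa using h)

lemma language_right {u v : List A} (h : u ++ v ∈ language X) : v ∈ language X :=
  language_infix (w := []) (by simpa using h)

lemma exists_window_of_mem_nhds [DiscreteTopology A] {x : ℤ → A} {U : Set (ℤ → A)}
    (hU : U ∈ 𝓝 x) : ∃ n : ℕ, ∀ y, Set.EqOn y x (Set.Icc (-n : ℤ) n) → y ∈ U := by
  obtain ⟨V, hVU, hV, hx⟩ := mem_nhds_iff.1 hU
  obtain ⟨I, u, hu, hIV⟩ := isOpen_pi_iff.1 hV x hx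
  refine ⟨I.sup Int.natAbs, fun y hy => hVU (hIV fun i hi => ?_)⟩
  have : i.natAbs ≤ I.sup Int.natAbs := Finset.le_sup (f := Int.natAbs) hi
  rw [hy ⟨by omega, by omega⟩]
  exact (hu i hi).2

/-- A sequence is in the shift space if its central windows occur at the origin of points of it. -/
lemma mem_carrier_of_windows [DiscreteTopology A] {x : ℤ → A}
    (h : ∀ n : ℕ, ∃ y ∈ X.carrier, Set.EqOn y x (Set.Icc (-n : ℤ) n)) : x ∈ X.carrier := by
  rw [← X.isClosed.closure_eq, mem_closure_iff_nhds]
  intro U hU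
  obtain ⟨n, hn⟩ := exists_window_of_mem_nhds hU
  obtain ⟨y, hy, hyx⟩ := h n
  exact ⟨y, hn y hyx, hy⟩

lemma mem_carrier_of_words [DiscreteTopology A] {x : ℤ → A}
    (h : ∀ i u, Reads x i u → u ∈ language X) : x ∈ X.carrier := by
  refine mem_carrier_of_windows fun n => ?_
  obtain ⟨y, hy, hyx⟩ := mem_language_at (h (-n) _ (reads_ofFn x (-n) (2 * n + 1))) (-n)
  refine ⟨y, hy, fun i hi => ?_⟩
  have := hyx (i + n).toNat (by have := hi.1; have := hi.2; simp; omega)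
  have e : (-n : ℤ) + (i + n).toNat = i := by have := hi.1; omega
  simp only [List.getElem_ofFn, e] at this
  exact this

/-- Every continuous map from a shift space to a discrete space depends on a window only. -/
lemma exists_window_of_continuous [Finite A] [DiscreteTopology A] {β : Type*} [TopologicalSpace β]
    [DiscreteTopology β] {g : X.carrier → β} (hg : Continuous g) :
    ∃ n : ℕ, ∀ x y : X.carrier, Set.EqOn x.1 y.1 (Set.Icc (-n : ℤ) n) → g x = g y := by
  by_contra! hcon
  choose x y hxy hne using hcon
  obtain ⟨p, hp⟩ := exists_limit_of_seq fun n i => ((x n).1 i, (y n).1 i)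
  have hpx : (fun i => (p i).1) ∈ X.carrier := mem_carrier_of_windows fun n => by
    obtain ⟨m, -, hm⟩ := hp n
    exact ⟨x m, (x m).2, fun i hi => by simp [hm hi]⟩
  have hev : ∀ᶠ x in 𝓝 (⟨_, hpx⟩ : X.carrier), g x = g ⟨_, hpx⟩ :=
    hg.continuousAt.eventually ((isOpen_discrete {g ⟨_, hpx⟩}).mem_nhds rfl)
  rw [nhds_subtype, Filter.eventually_comap] at hev
  obtain ⟨n, hn⟩ := exists_window_of_mem_nhds hev
  obtain ⟨m, hnm, hm⟩ := hp n
  have h1 := hn (x m).1 (fun i hi => by simp [hm hi]) (x m) rfl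
  have h2 := hn (y m).1 (fun i hi => by
    have h3 := hxy m (show i ∈ Set.Icc (-m : ℤ) m from
      ⟨by linarith [hi.1, (Nat.cast_le (α := ℤ)).2 hnm],
        by linarith [hi.2, (Nat.cast_le (α := ℤ)).2 hnm]⟩)
    simp [hm hi, h3]) (y m) rfl
  exact hne m (h1.trans h2.symm)

/-- A factor code commutes with all powers of the shift. -/
lemma IsFactorCode.map_shift {B : Type*} [TopologicalSpace B] {Y : Subshift B ℤ}
    {π : X.carrier → Y.carrier} (hπ : IsFactorCode X Y π) (k : ℤ) (x : X.carrier) (i : ℤ) :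
    (π ⟨shift k x.1, X.mapsTo k x.2⟩).1 i = (π x).1 (k + i) := by
  have step : ∀ (x : X.carrier) i, (π ⟨shift 1 x.1, X.mapsTo 1 x.2⟩).1 i = (π x).1 (1 + i) :=
    fun x i => by
      have := congrArg (fun y => y.1 i) (hπ.commutes x)
      simpa [shiftMap] using this
  have hs : ∀ (a b : ℤ) (x : X.carrier) (h), (⟨shift a (shift b x.1), h⟩ : X.carrier)
      = ⟨shift (a + b) x.1, X.mapsTo _ x.2⟩ := fun a b x h => by
    ext i; simp [← add_assoc, add_comm a b]
  induction k generalizing i with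
  | zero => simp
  | succ k ih =>
    have := step ⟨shift k x.1, X.mapsTo _ x.2⟩ i
    rw [hs, ih] at this
    simp only [add_comm (k : ℤ) 1, this]
    exact congrArg _ (by ring)
  | pred k ih =>
    have := step ⟨shift (-k - 1) x.1, X.mapsTo _ x.2⟩ (i - 1)
    rw [hs] at this
    have e : (1 + (-(k : ℤ) - 1)) = -k := by ring
    have e' : (1 + (i - 1)) = i := by ring
    rw [e'] at this
    rw [← this, ← show -(k : ℤ) + (i - 1) = -k - 1 + i by ring, ← ih]
    simp only [e]

/-- The set of words that may follow the word `u` in points of `X`. -/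
def followers (X : Subshift A ℤ) (u : List A) : Set (List A) := {v | u ++ v ∈ language X}

/-- A sofic shift has only finitely many follower sets: the follower set of `u` depends only on
the windows that can be seen, in points of a covering shift of finite type, at the end of a lift
of `u`. -/
lemma finite_range_followers [DiscreteTopology A] (hX : IsSofic X) :
    (Set.range (followers X)).Finite := by
  obtain ⟨n, Z, φ, ⟨F, hF, hZ⟩, hφ⟩ := hX
  obtain ⟨K₁, hK₁⟩ := exists_window_of_continuous (X := Z) (g := fun z => (φ z).1 0)
    ((continuous_apply 0).comp (continuous_subtype_val.comp hφ.continuous))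
  obtain ⟨K₂, hK₂⟩ : ∃ K₂ : ℕ, ∀ p ∈ F, ∀ h ∈ p.support, h.natAbs ≤ K₂ := by
    obtain ⟨K₂, h⟩ := (hF.image fun p => p.support.sup Int.natAbs).bddAbove
    exact ⟨K₂, fun p hp i hi => (Finset.le_sup (f := Int.natAbs) hi).trans (h ⟨p, hp, rfl⟩)⟩
  obtain ⟨K, hKK₁, hKK₂⟩ : ∃ K, K₁ ≤ K ∧ K₂ ≤ K := ⟨max K₁ K₂, by simp, by simp⟩
  have hloc : ∀ (z z' : Z.carrier) (i : ℤ), (∀ j ∈ Set.Icc (i - K) (i + K), z.1 j = z'.1 j) →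
      (φ z).1 i = (φ z').1 i := by
    intro z z' i h
    have h1 := hφ.map_shift i z 0
    have h2 := hφ.map_shift i z' 0
    rw [add_zero] at h1 h2
    rw [← h1, ← h2]
    refine hK₁ _ _ fun j hj => h _ ⟨?_, ?_⟩ <;> have := hj.1 <;> have := hj.2 <;> omega
  -- `K` bounds the supports of the forbidden patterns, so each pattern of the spliced point lies
  -- within one of the two given points.
  have hsplice : ∀ z ∈ Z.carrier, ∀ z' ∈ Z.carrier, (∀ j ∈ Set.Icc (-K : ℤ) K, z j = z' j) →
      (fun i : ℤ => if i ≤ K then z i else z' i) ∈ Z.carrier := by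
    intro z hz z' hz' h
    rw [hZ] at hz hz' ⊢
    intro p hp g hocc
    rcases le_or_gt g 0 with hg | hg
    · refine hz p hp g fun i hi => ?_
      have h1 := hocc i hi
      have h2 := hK₂ p hp i hi
      beta_reduce at h1
      rwa [if_pos (by omega)] at h1
    · refine hz' p hp g fun i hi => ?_
      have h1 := hocc i hi
      have h2 := hK₂ p hp i hi
      rw [← h1]
      beta_reduce
      split_ifs with h3
      · exact (h _ ⟨by omega, h3⟩).symm
      · rfl
  -- The words `u` are placed to end just before the time `0`.
  let S : List A → Set (Set.Icc (-K : ℤ) K → Fin (n + 1)) := fun u =>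
    {b | ∃ z : Z.carrier, Reads (φ z).1 (-u.length) u ∧ ∀ j : Set.Icc (-K : ℤ) K, z.1 j = b j}
  have key : ∀ u u', S u = S u' → followers X u ⊆ followers X u' := by
    intro u u' hS v hv
    obtain ⟨x, hx, hr⟩ := mem_language_at hv (-u.length)
    obtain ⟨z, hz⟩ := hφ.surjective ⟨x, hx⟩
    obtain ⟨hr1, hr2⟩ := reads_append.1 hr
    have hmem : (fun j : Set.Icc (-K : ℤ) K => z.1 j) ∈ S u :=
      ⟨z, by rw [hz]; exact hr1, fun _ => rfl⟩
    rw [hS] at hmem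
    obtain ⟨z', hz', hzz'⟩ := hmem
    have hspl := hsplice z'.1 z'.2 z.1 z.2 fun j hj => hzz' ⟨j, hj⟩
    refine ⟨(φ ⟨_, hspl⟩).1, (φ _).2, -u'.length, reads_append.2 ⟨fun j hj => ?_, fun j hj => ?_⟩⟩
    · rw [← hz' j hj]
      refine hloc _ _ _ fun i hi => ?_
      have := hi.2
      exact if_pos (by omega)
    · rw [← hr2 j hj]
      trans (φ z).1 (-u'.length + u'.length + j)
      · refine hloc _ _ _ fun i hi => ?_
        have := hi.1
        simp only
        split_ifs with h
        · exact hzz' ⟨i, by omega, h⟩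
        · rfl
      · rw [hz]; simp
  classical
  refine (Set.finite_range fun s => if h : ∃ u, S u = s then followers X h.choose else ∅).subset ?_
  rintro _ ⟨u, rfl⟩
  have h : ∃ u', S u' = S u := ⟨u, rfl⟩
  refine ⟨S u, ?_⟩
  simp only [dif_pos h]
  exact (key _ _ h.choose_spec).antisymm (key _ _ h.choose_spec.symm)

end Words

/-! ### The Fischer cover -/

section FischerCover

variable {A : Type*}

/-- The set of words that remain to be read after the symbol `a` has been read from `q`. -/
def quotientBy (q : Set (List A)) (a : A) : Set (List A) := {v | a :: v ∈ q}

variable [TopologicalSpace A] {X : Subshift A ℤ}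

lemma followers_append_singleton (u : List A) (a : A) :
    followers X (u ++ [a]) = quotientBy (followers X u) a := by
  ext v; simp [followers, quotientBy]

/-- The word `m` is synchronizing in `X`: no past of `m` restricts its future. -/
structure IsSynchronizing (X : Subshift A ℤ) (m : List A) : Prop where
  mem : m ∈ language X
  followers_append : ∀ u, u ++ m ∈ language X → followers X (u ++ m) = followers X m

/-- A word with a minimal follower set is synchronizing. -/
lemma exists_isSynchronizing [DiscreteTopology A] (hX : IsSofic X) (hne : X.carrier.Nonempty) :
    ∃ m, IsSynchronizing X m := by
  have hfin : (followers X '' language X).Finite :=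
    (finite_range_followers hX).subset (Set.image_subset_range _ _)
  obtain ⟨x, hx⟩ := hne
  have h0 : (followers X '' language X).Nonempty :=
    ⟨_, [], ⟨x, hx, 0, reads_nil _ _⟩, rfl⟩
  obtain ⟨_, ⟨⟨m, hm, rfl⟩, hmin⟩⟩ := hfin.exists_minimal h0
  refine ⟨m, hm, fun u hu => ?_⟩
  have hle : followers X (u ++ m) ≤ followers X m := fun v hv => by
    simp only [followers, Set.mem_ofPred_eq, List.append_assoc] at hv ⊢
    exact language_right hv
  exact hle.antisymm (hmin ⟨_, hu, rfl⟩ hle)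

lemma IsSynchronizing.followers_append_append {m : List A} (hm : IsSynchronizing X m) {u : List A}
    (hu : u ++ m ∈ language X) (v : List A) :
    followers X (u ++ m ++ v) = followers X (m ++ v) := by
  have := hm.followers_append u hu
  ext w
  have h := Set.ext_iff.1 this (v ++ w)
  simpa [followers] using h

/-- The states of the Fischer cover: the follower sets of the words of `X` that begin with a fixed
synchronizing word `m`. -/
abbrev FischerState (X : Subshift A ℤ) (m : List A) : Type _ :=
  {q : Set (List A) // ∃ v, m ++ v ∈ language X ∧ q = followers X (m ++ v)}

lemma finite_fischerState [DiscreteTopology A] (hX : IsSofic X) (m : List A) :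
    Finite (FischerState X m) := by
  have : {q : Set (List A) | ∃ v, m ++ v ∈ language X ∧ q = followers X (m ++ v)}.Finite := by
    refine (finite_range_followers hX).subset ?_
    rintro _ ⟨v, -, rfl⟩
    exact ⟨_, rfl⟩
  exact this.to_subtype

/-- The state sequence `q` is a run of the Fischer cover that reads `x`. -/
def IsRun {m : List A} (x : ℤ → A) (q : ℤ → FischerState X m) : Prop :=
  ∀ i, (q (i + 1)).1 = quotientBy (q i).1 (x i)

variable {m : List A}

lemma IsRun.shift {x : ℤ → A} {q : ℤ → FischerState X m} (h : IsRun x q) (k : ℤ) :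
    IsRun (fun i => x (i + k)) (fun i => q (i + k)) := fun i => by
  have := h (i + k)
  rwa [add_right_comm] at this

/-- Only points of `X` are read by runs: the states are nonempty sets, closed under prefixes, and
contain all words that are read from them. -/
lemma IsRun.mem_carrier [DiscreteTopology A] {x : ℤ → A} {q : ℤ → FischerState X m}
    (h : IsRun x q) : x ∈ X.carrier := by
  have hnil : ∀ p : FischerState X m, [] ∈ p.1 := by
    rintro ⟨_, v, hv, rfl⟩
    simpa [followers] using hv
  have hmem : ∀ u i, Reads x i u → u ∈ (q i).1 := by
    intro u
    induction u with
    | nil => exact fun i _ => hnil _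
    | cons a u ih =>
      intro i hr
      obtain ⟨rfl, hr'⟩ := reads_cons.1 hr
      have := ih _ hr'
      rwa [h i] at this
  refine mem_carrier_of_words fun i u hu => ?_
  obtain ⟨v, -, hq⟩ := (q i).2
  have := hmem u i hu
  rw [hq] at this
  exact language_right this

/-- Any two runs can be joined by reading a suitable word in between. -/
lemma exists_join_runs (hm : IsSynchronizing X m) (hirr : IsIrreducible X) {x x' : ℤ → A}
    {q q' : ℤ → FischerState X m} (h : IsRun x q) (h' : IsRun x' q') :
    ∃ (k : ℕ) (x'' : ℤ → A) (q'' : ℤ → FischerState X m), IsRun x'' q'' ∧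
      (∀ i < 0, x'' i = x i) ∧ (∀ i ≤ 0, q'' i = q i) ∧
      (∀ i ≥ 0, x'' (i + k) = x' i) ∧ ∀ i ≥ 0, q'' (i + k) = q' i := by
  obtain ⟨v, hv, hq⟩ := (q 0).2
  obtain ⟨v', hv', hq'⟩ := (q' 0).2
  obtain ⟨w, hw⟩ := hirr _ hv _ hv'
  set l := w ++ m ++ v' with hl
  have hmvl : m ++ (v ++ l) ∈ language X := by simpa [hl] using hw
  have hpre : ∀ j, m ++ (v ++ l.take j) ∈ language X := fun j => by
    rw [← List.take_append_drop j l] at hmvl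
    refine language_left (v := l.drop j) ?_
    simpa using hmvl
  -- The state after the first `j` letters of the joining word `l`.
  let s : ℕ → FischerState X m := fun j => ⟨_, _, hpre j, rfl⟩
  have hs0 : s 0 = q 0 := Subtype.ext (by simp [s, hq])
  have hsl : s l.length = q' 0 := Subtype.ext (by
    have := hm.followers_append_append (u := m ++ v ++ w) (language_left (v := v')
      (by simpa only [List.append_assoc] using hw)) v'
    simp only [s, hq', List.take_length, ← this, hl, List.append_assoc])
  have hs : ∀ (j : ℕ) (hj : j < l.length), (s (j + 1)).1 = quotientBy (s j).1 l[j] :=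
    fun j hj => by
      rw [← followers_append_singleton]
      change followers X (m ++ (v ++ l.take (j + 1))) = followers X (m ++ (v ++ l.take j) ++ [l[j]])
      rw [List.take_add_one, List.getElem?_eq_getElem hj]
      simp only [Option.toList_some, List.append_assoc]
  refine ⟨l.length, fun i => if i < 0 then x i else if hi : i.toNat < l.length then l[i.toNat]
    else x' (i - l.length), fun i => if i ≤ 0 then q i else if i ≤ l.length then s i.toNat else
      q' (i - l.length), fun i => ?_, fun i hi => ?_, fun i hi => ?_, fun i hi => ?_,
      fun i hi => ?_⟩
  · have hcase : ∀ j : ℕ, (if (j : ℤ) ≤ 0 then q j else if (j : ℤ) ≤ l.length then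
        s (j : ℤ).toNat else q' (j - l.length)) = if j ≤ l.length then s j else
          q' (j - l.length) := by
      rintro (_ | j)
      · simp [hs0]
      · rw [if_neg (by omega)]
        simp only [Nat.cast_le, Int.toNat_natCast]
    beta_reduce
    rcases lt_or_ge i 0 with hi | hi
    · rw [if_pos (by omega), if_pos (by omega), if_pos hi]
      exact h i
    · lift i to ℕ using hi
      have := hcase (i + 1)
      push_cast at this
      rw [this, hcase i, if_neg (show ¬ (i : ℤ) < 0 by omega)]
      simp only [Int.toNat_natCast]
      rcases lt_trichotomy i l.length with hi | hi | hi
      · rw [if_pos (by omega), if_pos (by omega), dif_pos hi]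
        exact hs i hi
      · rw [if_neg (by omega), if_pos (by omega), dif_neg (by omega), hi, hsl]
        simpa using h' 0
      · rw [if_neg (by omega), if_neg (by omega), dif_neg (by omega), ← h']
        congr 2; ring
  · simp [hi]
  · simp [hi]
  · beta_reduce
    rw [if_neg (by omega), dif_neg (by omega)]; simp
  · beta_reduce
    rcases hi.eq_or_lt with rfl | hi'
    · rw [← hsl]
      by_cases h0 : l.length = 0
      · simp [h0, hs0]
      · rw [if_neg (by omega), if_pos (by omega)]; simp
    · rw [if_neg (by omega), if_neg (by omega)]; simp

/-- Every point of `X` is read by a run: by irreducibility its finite words can be read starting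
from the state of `m`, and runs over longer and longer words converge. -/
lemma exists_isRun [DiscreteTopology A] [Finite (FischerState X m)] (hm : IsSynchronizing X m)
    (hirr : IsIrreducible X) {x : ℤ → A} (hx : x ∈ X.carrier) :
    ∃ q : ℤ → FischerState X m, IsRun x q := by
  have key : ∀ n : ℕ, ∃ q : ℤ → FischerState X m, ∀ i, -(n : ℤ) ≤ i → i < n →
      (q (i + 1)).1 = quotientBy (q i).1 (x i) := by
    intro n
    set u := List.ofFn fun j : Fin (2 * n) => x (-n + j) with hu
    obtain ⟨w, hw⟩ := hirr m hm.mem u ⟨x, hx, -n, reads_ofFn _ _ _⟩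
    have hpre : ∀ j, m ++ (w ++ u.take j) ∈ language X := fun j => by
      rw [← List.take_append_drop j u] at hw
      refine language_left (v := u.drop j) ?_
      simpa only [List.append_assoc] using hw
    refine ⟨fun i => ⟨_, _, hpre (i + n).toNat, rfl⟩, fun i h1 h2 => ?_⟩
    obtain ⟨j, hj⟩ : ∃ j : ℕ, i + n = j := ⟨(i + n).toNat, by omega⟩
    have e1 : (i + 1 + n).toNat = j + 1 := by omega
    have e2 : (i + n).toNat = j := by omega
    have e3 : x i = u[j]'(by simp [hu]; omega) := by
      simp only [hu, List.getElem_ofFn]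
      exact congrArg x (by omega)
    have e4 : j < u.length := by simp [hu]; omega
    simp only [e1, e2, e3]
    rw [← followers_append_singleton]
    rw [List.take_add_one, List.getElem?_eq_getElem e4]
    simp only [Option.toList_some, List.append_assoc]
  choose q hq using key
  obtain ⟨q', hq'⟩ := exists_limit_of_seq q
  refine ⟨q', fun i => ?_⟩
  obtain ⟨n, hn, h⟩ := hq' (i.natAbs + 1)
  rw [h ⟨by omega, by omega⟩, h ⟨by omega, by omega⟩]
  exact hq n i (by omega) (by omega)

/-- The Fischer cover is finite-to-one, since it is deterministic: distinct runs over the same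
point show distinct states at every sufficiently early time. -/
lemma finite_setOf_isRun [Finite (FischerState X m)] (x : ℤ → A) :
    {q : ℤ → FischerState X m | IsRun x q}.Finite := by
  by_contra hinf
  obtain ⟨t, ht, htc⟩ := Set.Infinite.exists_subset_card_eq hinf (Nat.card (FischerState X m) + 1)
  have hdet : ∀ q ∈ t, ∀ q' ∈ t, q ≠ q' → ∀ᶠ i in atBot, q i ≠ q' i := by
    intro q hq q' hq' hne
    obtain ⟨i₀, hi₀⟩ := Function.ne_iff.1 hne
    filter_upwards [eventually_le_atBot i₀] with i hi heq
    refine hi₀ ?_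
    induction i₀, hi using Int.leInduction with
    | base => exact heq
    | succ k _ ih =>
      by_cases hk : q k = q' k
      · exact Subtype.ext (by rw [ht hq k, ht hq' k, hk])
      · exact absurd (ih hk) hk
  have hall : ∀ᶠ i in atBot, ∀ q ∈ t, ∀ q' ∈ t, q ≠ q' → q i ≠ q' i := by
    refine (eventually_all_finset t).2 fun q hq => (eventually_all_finset t).2 fun q' hq' => ?_
    by_cases hne : q = q'
    · simp [hne]
    · filter_upwards [hdet q hq q' hq' hne] with i hi _ using hi
  obtain ⟨i, hi⟩ := hall.exists
  have hinj : Set.InjOn (fun q : ℤ → FischerState X m => q i) t := fun q hq q' hq' h => by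
    by_contra hne
    exact hi q hq q' hq' hne h
  have := hinj.ncard_image
  have h2 := Set.ncard_le_card ((fun q : ℤ → FischerState X m => q i) '' t)
  rw [this, Set.ncard_coe_finset, htc] at h2
  omega

end FischerCover

/-! ### The degree of a finite-to-one factor code -/

section WindowCover

universe u

variable {A : Type u} [TopologicalSpace A] {X : Subshift A ℤ} {m : List A} {N : ℕ}

/-- The centre of the window `[-N, N]`. -/
abbrev windowCenter (N : ℕ) : Set.Icc (-N : ℤ) N := ⟨0, by simp⟩

/-- The transitions between consecutive pairs (window of radius `N`, state) along a run of the
Fischer cover. -/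
def windowRel (X : Subshift A ℤ) (m : List A) (N : ℕ)
    (e e' : (Set.Icc (-N : ℤ) N → A) × FischerState X m) : Prop :=
  (∀ j j' : Set.Icc (-N : ℤ) N, j'.1 = j.1 + 1 → e'.1 j = e.1 j') ∧
    e'.2.1 = quotientBy e.2.1 (e.1 (windowCenter N))

/-- The sequence of pairs (window of radius `N` around the time `i`, state at the time `i`). -/
def windowRun (N : ℕ) (x : ℤ → A) (q : ℤ → FischerState X m) (i : ℤ) :
    (Set.Icc (-N : ℤ) N → A) × FischerState X m :=
  (fun j => x (i + j), q i)

lemma IsRun.windowRun_mem {x : ℤ → A} {q : ℤ → FischerState X m} (h : IsRun x q) :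
    windowRun N x q ∈ chains (windowRel X m N) := by
  refine fun i => ⟨fun j j' hj => ?_, ?_⟩
  · simp only [windowRun, hj]
    exact congrArg x (by ring)
  · simpa [windowRun] using h i

/-- All chains of `windowRel` come from runs: the entry at the place `j` of the window at the time
`i` is the centre of the window at the time `i + j`. -/
lemma exists_windowRun_eq {z : ℤ → (Set.Icc (-N : ℤ) N → A) × FischerState X m}
    (hz : z ∈ chains (windowRel X m N)) :
    ∃ (x : ℤ → A) (q : ℤ → FischerState X m), IsRun x q ∧ windowRun N x q = z := by
  refine ⟨fun i => (z i).1 (windowCenter N), fun i => (z i).2, fun i => (hz i).2, ?_⟩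
  have hpos : ∀ (a : ℕ) (ha : (a : ℤ) ∈ Set.Icc (-N : ℤ) N) (i : ℤ),
      (z (i + a)).1 (windowCenter N) = (z i).1 ⟨a, ha⟩ := by
    intro a
    induction a with
    | zero => intro _ i; simp
    | succ a ih =>
      intro ha i
      have ha' : (a : ℤ) ∈ Set.Icc (-N : ℤ) N :=
        ⟨by omega, by have := ha.2; push_cast at this; omega⟩
      rw [← (hz i).1 ⟨a, ha'⟩ ⟨((a + 1 : ℕ) : ℤ), ha⟩ (by simp), ← ih ha' (i + 1)]
      exact congrArg (fun k => (z k).1 (windowCenter N)) (by push_cast; ring)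
  have hneg : ∀ (a : ℕ) (ha : -(a : ℤ) ∈ Set.Icc (-N : ℤ) N) (i : ℤ),
      (z (i + -a)).1 (windowCenter N) = (z i).1 ⟨-a, ha⟩ := by
    intro a
    induction a with
    | zero => intro _ i; simp
    | succ a ih =>
      intro ha i
      have ha' : -(a : ℤ) ∈ Set.Icc (-N : ℤ) N :=
        ⟨by have := ha.1; push_cast at this; omega, by omega⟩
      have := (hz (i - 1)).1 ⟨-((a + 1 : ℕ) : ℤ), ha⟩ ⟨-(a : ℤ), ha'⟩ (by push_cast; ring)
      rw [sub_add_cancel] at this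
      rw [this, ← ih ha' (i - 1)]
      exact congrArg (fun k => (z k).1 (windowCenter N)) (by push_cast; ring)
  ext i : 1
  refine Prod.ext (funext fun ⟨j, hj⟩ => ?_) rfl
  simp only [windowRun]
  obtain ⟨a, rfl | rfl⟩ := j.eq_nat_or_neg
  · exact hpos a hj i
  · exact hneg a hj i

/-- An irreducible sofic shift is the finite-to-one image of an irreducible Markov shift, whose
symbols may be taken to record the window of radius `N` of the point below. -/
theorem exists_irreducible_cover [Finite A] [DiscreteTopology A] (hX : IsSofic X)
    (hirr : IsIrreducible X) (hne : X.carrier.Nonempty) (N : ℕ) :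
    ∃ (E : Type u) (_ : Finite E) (R : E → E → Prop) (a : E → Set.Icc (-N : ℤ) N → A),
      (∀ z ∈ chains R, ∀ z' ∈ chains R, ∃ k : ℕ, ∃ z'' ∈ chains R,
        (∀ i ≤ 0, z'' i = z i) ∧ ∀ i ≥ 0, z'' (i + k) = z' i) ∧
      (∀ z ∈ chains R, ∃ x ∈ X.carrier, ∀ i j, a (z i) j = x (i + j)) ∧
      (∀ x ∈ X.carrier, ∃ z ∈ chains R, ∀ i j, a (z i) j = x (i + j)) ∧
      ∀ x : ℤ → A, {z ∈ chains R | ∀ i, a (z i) (windowCenter N) = x i}.Finite := by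
  obtain ⟨m, hm⟩ := exists_isSynchronizing hX hne
  have := finite_fischerState hX m
  refine ⟨(Set.Icc (-N : ℤ) N → A) × FischerState X m, inferInstance, windowRel X m N, Prod.fst,
    ?_, ?_, ?_, ?_⟩
  · intro z hz z' hz'
    obtain ⟨x, q, h, rfl⟩ := exists_windowRun_eq hz
    obtain ⟨x', q', h', rfl⟩ := exists_windowRun_eq hz'
    obtain ⟨k, x'', q'', h'', h1, h2, h3, h4⟩ := exists_join_runs hm hirr (h.shift (N + 1))
      (h'.shift (-N))
    refine ⟨k + 2 * N + 1, _, (h''.shift (-N - 1)).windowRun_mem, fun i hi => ?_, fun i hi => ?_⟩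
    · refine Prod.ext (funext fun ⟨j, hj⟩ => ?_) ?_
      · simp only [windowRun]
        rw [h1 _ (by have := hj.2; omega)]
        exact congrArg x (by ring)
      · simp only [windowRun]
        rw [h2 _ (by omega)]
        exact congrArg q (by ring)
    · refine Prod.ext (funext fun ⟨j, hj⟩ => ?_) ?_
      · simp only [windowRun]
        have := h3 (i + j + N) (by have := hj.1; omega)
        rw [show i + j + N + -N = i + j by ring] at this
        rw [← this]
        exact congrArg x'' (by push_cast; ring)
      · simp only [windowRun]
        have := h4 (i + N) (by omega)
        rw [show i + N + -N = i by ring] at this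
        rw [← this]
        exact congrArg q'' (by push_cast; ring)
  · intro z hz
    obtain ⟨x, q, h, rfl⟩ := exists_windowRun_eq hz
    exact ⟨x, h.mem_carrier, fun i j => rfl⟩
  · intro x hx
    obtain ⟨q, hq⟩ := exists_isRun hm hirr hx
    exact ⟨_, hq.windowRun_mem, fun i j => rfl⟩
  · intro x
    refine ((finite_setOf_isRun x).image (windowRun N x)).subset ?_
    rintro z ⟨hz, hzx⟩
    obtain ⟨x', q, h, rfl⟩ := exists_windowRun_eq hz
    have : x' = x := funext fun i => by simpa [windowRun] using hzx i
    subst this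
    exact ⟨q, h, rfl⟩

end WindowCover

section Degree

variable {A B : Type*} [TopologicalSpace A] [TopologicalSpace B]
  {X : Subshift A ℤ} {Y : Subshift B ℤ}

/-- The central windows of points of `Y` recur in every doubly transitive point. -/
lemma IsDoublyTransitive.recurs {y : Y.carrier} (hy : IsDoublyTransitive Y y) {w : ℤ → B}
    (hw : w ∈ Y.carrier) (n : ℕ) : Recurs n w y.1 := by
  have hmem : (List.ofFn fun j : Fin (2 * n + 1) => w (-n + j)) ∈ language Y :=
    ⟨w, hw, -n, reads_ofFn _ _ _⟩
  have key : ∀ s, Reads y.1 s (List.ofFn fun j : Fin (2 * n + 1) => w (-n + j)) →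
      OccursAt n w y.1 (s + n) := by
    intro s hs j hj
    have h1 := hj.1
    have h2 := hj.2
    have := hs (j + n).toNat (by simp; omega)
    simp only [List.getElem_ofFn] at this
    rw [show s + n + j = s + (j + n).toNat by omega, this]
    exact congrArg w (by omega)
  intro N
  obtain ⟨s, hs, hs'⟩ := (hy _ hmem N).1
  obtain ⟨t, ht, ht'⟩ := (hy _ hmem (N - n)).2
  exact ⟨⟨s + n, by omega, key s hs'⟩, ⟨t + n, by omega, key t ht'⟩⟩

/-- The degree of a finite-to-one factor code on an irreducible sofic shift is well defined. Over a
doubly transitive point `y` the number of chains of the Markov cover is constant, and each point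
over `y` has in turn the same number of chains over it, because all chains over `y` recur. -/
theorem exists_encard_fiber_eq [Finite A] [DiscreteTopology A] [DiscreteTopology B]
    (hX : IsSofic X) (hirr : IsIrreducible X) {π : X.carrier → Y.carrier}
    (hπ : IsFactorCode X Y π) (hfin : IsFiniteToOne π) :
    ∃ d : ℕ, ∀ y : Y.carrier, IsDoublyTransitive Y y → (π ⁻¹' {y}).encard = d := by
  rcases X.carrier.eq_empty_or_nonempty with hem | hne
  · refine ⟨0, fun y _ => ?_⟩
    obtain ⟨x, -⟩ := hπ.surjective y
    exact absurd x.2 (by simp [hem])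
  obtain ⟨N, hN⟩ := exists_window_of_continuous (X := X) (g := fun x => (π x).1 0)
    ((continuous_apply 0).comp (continuous_subtype_val.comp hπ.continuous))
  obtain ⟨E, _, R, a, hjoin, hdown, hup, hfinA'⟩ := exists_irreducible_cover hX hirr hne N
  let fA : E → A := fun e => a e (windowCenter N)
  -- A window of radius `N` of a point determines the central symbol of its image, so both the point
  -- and its image are read off from the chain by one-block codes.
  have hB : ∃ fB : E → B, ∀ z ∈ chains R, ∃ x : X.carrier, fA ∘ z = x.1 ∧ fB ∘ z = (π x).1 := by
    classical
    have hBne : Nonempty B := ⟨(π ⟨_, hne.some_mem⟩).1 0⟩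
    refine ⟨fun e => if h : ∃ x : X.carrier, ∀ j, a e j = x.1 j then (π h.choose).1 0
      else Classical.choice hBne, fun z hz => ?_⟩
    obtain ⟨x, hx, hax⟩ := hdown z hz
    refine ⟨⟨x, hx⟩, funext fun i => by simp [fA, hax], funext fun i => ?_⟩
    have h : ∃ x : X.carrier, ∀ j, a (z i) j = x.1 j :=
      ⟨⟨shift i x, X.mapsTo i hx⟩, fun j => by simp [hax]⟩
    simp only [Function.comp, dif_pos h]
    have h1 := hπ.map_shift i ⟨x, hx⟩ 0
    rw [add_zero] at h1
    rw [← h1]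
    refine hN _ _ fun j hj => ?_
    rw [← h.choose_spec ⟨j, hj⟩, hax]
    rfl
  obtain ⟨fB, hfB⟩ := hB
  have hlift : ∀ x : X.carrier, ∃ z ∈ chains R, fA ∘ z = x.1 ∧ fB ∘ z = (π x).1 := by
    intro x
    obtain ⟨z, hz, hzx⟩ := hup x.1 x.2
    obtain ⟨x', h1, h2⟩ := hfB z hz
    have : x' = x := Subtype.ext (by rw [← h1]; ext i; simp [fA, hzx])
    exact ⟨z, hz, this ▸ h1, this ▸ h2⟩
  have hfinA : ∀ x : ℤ → A, {z ∈ chains R | fA ∘ z = x}.Finite := fun x =>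
    (hfinA' x).subset fun z hz => ⟨hz.1, congrFun hz.2⟩
  have hfinB : ∀ y : ℤ → B, {z ∈ chains R | fB ∘ z = y}.Finite := by
    intro y
    by_cases hy : y ∈ Y.carrier
    · refine ((hfin ⟨y, hy⟩).biUnion fun x _ => hfinA x.1).subset ?_
      rintro z ⟨hz, rfl⟩
      obtain ⟨x, h1, h2⟩ := hfB z hz
      exact Set.mem_biUnion (x := x) (Subtype.ext h2.symm) ⟨hz, h1⟩
    · convert Set.finite_empty
      refine Set.eq_empty_of_forall_notMem ?_
      rintro z ⟨hz, rfl⟩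
      obtain ⟨x, -, h2⟩ := hfB z hz
      exact hy (h2 ▸ (π x).2)
  have hRne : (chains R).Nonempty := by
    obtain ⟨z, hz, -⟩ := hup _ hne.some_mem
    exact ⟨z, hz⟩
  obtain ⟨wA, nA, hA⟩ := exists_isMagic (f := fA) hRne
  obtain ⟨wB, nB, hB⟩ := exists_isMagic (f := fB) hRne
  obtain ⟨uA, huA, rfl⟩ := hA.exists_chain
  obtain ⟨uB, huB, rfl⟩ := hB.exists_chain
  obtain ⟨z₀, hz₀, n', hn'⟩ := exists_recurs_of_label_recurs hB hfinB hjoin huA nA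
  have hmemY : ∀ z ∈ chains R, fB ∘ z ∈ Y.carrier := fun z hz => by
    obtain ⟨x, -, h2⟩ := hfB z hz
    exact h2 ▸ (π x).2
  refine ⟨(windowSet R fB (fB ∘ uB) nB).ncard / (windowSet R fA (fA ∘ uA) nA).ncard,
    fun y hy => ?_⟩
  have hpos : 0 < (windowSet R fA (fA ∘ uA) nA).ncard :=
    (Set.ncard_pos (Set.toFinite _)).2 (windowSet_nonempty hA)
  have hcardB : {z ∈ chains R | fB ∘ z = y.1}.ncard = (windowSet R fB (fB ∘ uB) nB).ncard := by
    obtain ⟨x, rfl⟩ := hπ.surjective y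
    obtain ⟨z, hz, -, h2⟩ := hlift x
    have := hB.encard_fiber hfinB hz (by rw [h2]; exact hy.recurs (hmemY _ huB) nB)
    rw [h2] at this
    rw [Set.ncard, this, ← Set.ncard]
  have hcardA : ∀ x ∈ π ⁻¹' {y}, {z ∈ chains R | fA ∘ z = x.1}.ncard =
      (windowSet R fA (fA ∘ uA) nA).ncard := by
    rintro x rfl
    obtain ⟨z, hz, h1, h2⟩ := hlift x
    have hrec := hn' z hz (by rw [h2]; exact hy.recurs (hmemY _ hz₀) n')
    have := hA.encard_fiber hfinA hz fun N => by
      obtain ⟨⟨s, hs, hs'⟩, t, ht, ht'⟩ := hrec N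
      exact ⟨⟨s, hs, fun j hj => congrArg fA (hs' j hj)⟩, t, ht,
        fun j hj => congrArg fA (ht' j hj)⟩
    rw [h1] at this
    rw [Set.ncard, this, ← Set.ncard]
  -- The chains over `y` are partitioned by the points over `y` that they lie over.
  have hmul : {z ∈ chains R | fB ∘ z = y.1}.ncard =
      (π ⁻¹' {y}).ncard * (windowSet R fA (fA ∘ uA) nA).ncard := by
    classical
    have hT := (hfin y).image Subtype.val
    rw [Set.ncard_eq_toFinset_card _ (hfinB y.1),
      ← Set.ncard_image_of_injective _ Subtype.val_injective, Set.ncard_eq_toFinset_card _ hT,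
      Finset.card_eq_sum_card_fiberwise (f := fun z => fA ∘ z) (t := hT.toFinset)]
    · refine Finset.sum_const_nat fun x hx => ?_
      obtain ⟨x, hxy, rfl⟩ := hT.mem_toFinset.1 hx
      rw [← hcardA x hxy, Set.ncard_eq_toFinset_card _ (hfinA x.1)]
      congr 1
      ext z
      simp only [Finset.mem_filter, Set.Finite.mem_toFinset, Set.mem_ofPred_eq]
      refine ⟨fun h => ⟨h.1.1, h.2⟩, fun h => ⟨⟨h.1, ?_⟩, h.2⟩⟩
      obtain ⟨x', h1, h2⟩ := hfB z h.1
      have : x' = x := Subtype.ext (h1.symm.trans h.2)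
      rw [h2, this, hxy]
    · intro z hz
      have hz' := (hfinB y.1).mem_toFinset.1 hz
      obtain ⟨x, h1, h2⟩ := hfB z hz'.1
      exact hT.mem_toFinset.2 ⟨x, Subtype.ext (h2.symm.trans hz'.2), h1.symm⟩
  rw [← (hfin y).cast_ncard_eq, ← hcardB, hmul, Nat.mul_div_cancel _ hpos]

/-- The number `degree π` has its defining property. -/
lemma encard_fiber_eq_degree [Finite A] [DiscreteTopology A] [DiscreteTopology B]
    (hX : IsSofic X) (hirr : IsIrreducible X) {π : X.carrier → Y.carrier}
    (hπ : IsFactorCode X Y π) (hfin : IsFiniteToOne π) {y : Y.carrier}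
    (hy : IsDoublyTransitive Y y) : (π ⁻¹' {y}).encard = degree π := by
  have h := exists_encard_fiber_eq hX hirr hπ hfin
  rw [degree, dif_pos h]
  exact h.choose_spec y hy

end Degree

/-! ### The pointwise ergodic theorem and generic points -/

section Birkhoff

variable {α : Type*}

/-- The maximum of `0` and the first `n` Birkhoff sums of `f`, defined recursively. -/
noncomputable def maxBirkhoffSum (T : α → α) (f : α → ℝ) : ℕ → α → ℝ
  | 0, _ => 0
  | n + 1, x => max 0 (f x + maxBirkhoffSum T f n (T x))

variable {T : α → α} {f : α → ℝ}

lemma maxBirkhoffSum_nonneg (n : ℕ) (x : α) : 0 ≤ maxBirkhoffSum T f n x := by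
  cases n with
  | zero => exact le_rfl
  | succ n => exact le_max_left _ _

lemma maxBirkhoffSum_mono (x : α) : Monotone fun n => maxBirkhoffSum T f n x := by
  refine monotone_nat_of_le_succ fun n => ?_
  induction n generalizing x with
  | zero => exact maxBirkhoffSum_nonneg 1 x
  | succ n ih => exact max_le_max le_rfl (add_le_add le_rfl (ih (T x)))

lemma birkhoffSum_le_maxBirkhoffSum (n : ℕ) (x : α) :
    birkhoffSum T f n x ≤ maxBirkhoffSum T f n x := by
  induction n generalizing x with
  | zero => simp [maxBirkhoffSum]
  | succ n ih =>
    rw [birkhoffSum_succ']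
    exact (add_le_add le_rfl (ih (T x))).trans (le_max_right _ _)

variable [MeasurableSpace α] {μ : Measure α}

lemma measurable_maxBirkhoffSum (hT : Measurable T) (hf : Measurable f) (n : ℕ) :
    Measurable (maxBirkhoffSum T f n) := by
  induction n with
  | zero => exact measurable_const
  | succ n ih => exact measurable_const.max (hf.add (ih.comp hT))

lemma integrable_maxBirkhoffSum [IsFiniteMeasure μ] (hT : MeasurePreserving T μ μ)
    (hf : Integrable f μ) (n : ℕ) : Integrable (maxBirkhoffSum T f n) μ := by
  induction n with
  | zero => exact integrable_const 0
  | succ n ih => exact (integrable_const 0).sup (hf.add (hT.integrable_comp_of_integrable ih))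

/-- The maximal ergodic theorem. -/
lemma setIntegral_maxBirkhoffSum_pos_nonneg [IsFiniteMeasure μ] (hT : MeasurePreserving T μ μ)
    (hfm : Measurable f) (hf : Integrable f μ) (n : ℕ) :
    0 ≤ ∫ x in {x | 0 < maxBirkhoffSum T f n x}, f x ∂μ := by
  cases n with
  | zero => simp [maxBirkhoffSum]
  | succ n =>
    set D := {x | 0 < maxBirkhoffSum T f (n + 1) x}
    have hD : MeasurableSet D :=
      measurableSet_lt measurable_const (measurable_maxBirkhoffSum hT.measurable hfm _)
    have i1 := integrable_maxBirkhoffSum hT hf (n + 1)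
    have i0 := integrable_maxBirkhoffSum hT hf n
    have i2 : Integrable (fun x => maxBirkhoffSum T f n (T x)) μ :=
      hT.integrable_comp_of_integrable i0
    have e1 : ∫ x in D, f x ∂μ = ∫ x in D, maxBirkhoffSum T f (n + 1) x ∂μ -
        ∫ x in D, maxBirkhoffSum T f n (T x) ∂μ := by
      rw [← integral_sub i1.integrableOn i2.integrableOn]
      refine setIntegral_congr_fun hD fun x hx => ?_
      have hx' : 0 < max 0 (f x + maxBirkhoffSum T f n (T x)) := hx
      have : max 0 (f x + maxBirkhoffSum T f n (T x)) = f x + maxBirkhoffSum T f n (T x) := by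
        rcases max_choice 0 (f x + maxBirkhoffSum T f n (T x)) with h | h
        · rw [h] at hx'; exact absurd hx' (lt_irrefl _)
        · exact h
      simp only [maxBirkhoffSum, this]
      ring
    have e2 : ∫ x in D, maxBirkhoffSum T f (n + 1) x ∂μ = ∫ x, maxBirkhoffSum T f (n + 1) x ∂μ :=
      setIntegral_eq_integral_of_forall_compl_eq_zero fun x hx =>
        le_antisymm (not_lt.1 hx) (maxBirkhoffSum_nonneg _ _)
    have e3 : ∫ x in D, maxBirkhoffSum T f n (T x) ∂μ ≤ ∫ x, maxBirkhoffSum T f n (T x) ∂μ :=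
      setIntegral_le_integral i2 (ae_of_all _ fun x => maxBirkhoffSum_nonneg _ _)
    have e4 : ∫ x, maxBirkhoffSum T f n (T x) ∂μ = ∫ x, maxBirkhoffSum T f n x ∂μ := by
      have := integral_map (φ := T) hT.measurable.aemeasurable (f := maxBirkhoffSum T f n)
        (μ := μ) (by rw [hT.map_eq]; exact i0.aestronglyMeasurable)
      rw [← this, hT.map_eq]
    have e5 : ∫ x, maxBirkhoffSum T f n x ∂μ ≤ ∫ x, maxBirkhoffSum T f (n + 1) x ∂μ :=
      integral_mono i0 i1 fun x => maxBirkhoffSum_mono x (Nat.le_succ n)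
    linarith

/-- The Birkhoff sums of a function with negative integral are almost surely bounded above: the
set where they are not is invariant, and by the maximal ergodic theorem it is not of full
measure. -/
lemma ae_exists_birkhoffSum_le [IsProbabilityMeasure μ] (hT : Ergodic T μ)
    (hfm : Measurable f) (hf : Integrable f μ) (hneg : ∫ x, f x ∂μ < 0) :
    ∀ᵐ x ∂μ, ∃ c, ∀ n, birkhoffSum T f n x ≤ c := by
  -- `x` and `T x` lie in `D` together, since `maxBirkhoffSum T f (n + 1) x` and
  -- `maxBirkhoffSum T f n (T x)` differ by at most `|f x|`.
  set D := {x | ∀ c : ℕ, ∃ n, (c : ℝ) < maxBirkhoffSum T f n x} with hDdef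
  have hD : MeasurableSet D := by
    simp only [hDdef, Set.ofPred_forall, Set.ofPred_exists]
    exact .iInter fun c => .iUnion fun n =>
      measurableSet_lt measurable_const (measurable_maxBirkhoffSum hT.measurable hfm _)
  have hinv : T ⁻¹' D = D := by
    ext x
    constructor
    · intro h c
      obtain ⟨k, hk⟩ := exists_nat_gt (c - f x)
      obtain ⟨n, hn⟩ := h k
      exact ⟨n + 1, lt_max_of_lt_right (by linarith)⟩
    · intro h c
      obtain ⟨k, hk⟩ := exists_nat_gt (c + f x)
      obtain ⟨n, hn⟩ := h k
      cases n with
      | zero => exact absurd hn (not_lt.2 (by simp [maxBirkhoffSum]))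
      | succ n =>
        refine ⟨n, ?_⟩
        rcases lt_max_iff.1 hn with h | h
        · exact absurd h (not_lt.2 (Nat.cast_nonneg k))
        · linarith
  rcases hT.toPreErgodic.ae_mem_or_ae_notMem hD hinv with h | h
  · exfalso
    let S : ℕ → Set α := fun n => {x | 0 < maxBirkhoffSum T f n x}
    have hlim := tendsto_setIntegral_of_monotone (μ := μ) (f := f) (s := S)
      (fun n => measurableSet_lt measurable_const (measurable_maxBirkhoffSum hT.measurable hfm n))
      (fun a b hab x hx => lt_of_lt_of_le hx (maxBirkhoffSum_mono x hab)) hf.integrableOn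
    have hS : (⋃ n, S n : Set α) =ᵐ[μ] Set.univ := by
      rw [eventuallyEq_univ]
      filter_upwards [h] with x hx
      obtain ⟨n, hn⟩ := hx 0
      exact Set.mem_iUnion.2 ⟨n, show 0 < maxBirkhoffSum T f n x by simpa using hn⟩
    rw [setIntegral_congr_set hS, setIntegral_univ] at hlim
    exact absurd (ge_of_tendsto' hlim fun n =>
      setIntegral_maxBirkhoffSum_pos_nonneg hT.toMeasurePreserving hfm hf n) (not_le.2 hneg)
  · filter_upwards [h] with x hx
    simp only [hDdef, Set.mem_ofPred_eq, not_forall, not_exists, not_lt] at hx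
    obtain ⟨c, hc⟩ := hx
    exact ⟨c, fun n => (birkhoffSum_le_maxBirkhoffSum n x).trans (hc n)⟩

/-- The upper half of the pointwise ergodic theorem: the Birkhoff sums of `f - (∫ f + ε)` are
bounded above. -/
lemma ae_eventually_birkhoffAverage_lt [IsProbabilityMeasure μ] (hT : Ergodic T μ)
    (hfm : Measurable f) (hf : Integrable f μ) :
    ∀ᵐ x ∂μ, ∀ ε > 0, ∀ᶠ n in atTop, birkhoffAverage ℝ T f n x < ∫ z, f z ∂μ + ε := by
  have key : ∀ k : ℕ, ∀ᵐ x ∂μ, ∃ c, ∀ n,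
      birkhoffSum T (fun z => f z - (∫ z, f z ∂μ + 1 / ((k : ℝ) + 1))) n x ≤ c := by
    intro k
    have hk : (0 : ℝ) < 1 / ((k : ℝ) + 1) := by positivity
    refine ae_exists_birkhoffSum_le hT (hfm.sub measurable_const)
      (hf.sub (integrable_const _)) ?_
    rw [integral_sub hf (integrable_const _)]
    simp
    positivity
  filter_upwards [ae_all_iff.2 key] with x hx ε hε
  obtain ⟨k, hk⟩ := exists_nat_one_div_lt (half_pos hε)
  obtain ⟨c, hc⟩ := hx k
  obtain ⟨M, hM⟩ := exists_nat_gt (c / (ε / 2))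
  filter_upwards [eventually_ge_atTop (M + 1)] with n hn
  have hn0 : (0 : ℝ) < n := by exact_mod_cast (by omega : 0 < n)
  have h1 := hc n
  have h2 : birkhoffSum T (fun z => f z - (∫ z, f z ∂μ + 1 / ((k : ℝ) + 1))) n x =
      birkhoffSum T f n x - n * (∫ z, f z ∂μ + 1 / ((k : ℝ) + 1)) := by
    simp only [birkhoffSum, Finset.sum_sub_distrib, Finset.sum_const, Finset.card_range,
      nsmul_eq_mul]
  have h3 : c < n * (ε / 2) := by
    rw [div_lt_iff₀ (half_pos hε)] at hM
    refine hM.trans_le (mul_le_mul_of_nonneg_right ?_ (half_pos hε).le)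
    exact_mod_cast (by omega : M ≤ n)
  rw [birkhoffAverage, smul_eq_mul, inv_mul_lt_iff₀ hn0]
  have h4 : (n : ℝ) * (1 / ((k : ℝ) + 1)) ≤ n * (ε / 2) :=
    mul_le_mul_of_nonneg_left hk.le hn0.le
  rw [h2] at h1
  linarith

/-- Birkhoff's pointwise ergodic theorem for ergodic probability measures. -/
theorem ae_tendsto_birkhoffAverage [IsProbabilityMeasure μ] (hT : Ergodic T μ)
    (hfm : Measurable f) (hf : Integrable f μ) :
    ∀ᵐ x ∂μ, Tendsto (fun n => birkhoffAverage ℝ T f n x) atTop (𝓝 (∫ z, f z ∂μ)) := by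
  filter_upwards [ae_eventually_birkhoffAverage_lt hT hfm hf,
    ae_eventually_birkhoffAverage_lt hT hfm.neg hf.neg] with x h1 h2
  rw [Metric.tendsto_nhds]
  intro ε hε
  filter_upwards [h1 ε hε, h2 ε hε] with n h3 h4
  rw [birkhoffAverage_neg] at h4
  simp only [Pi.neg_apply, integral_neg] at h4
  rw [Real.dist_eq, abs_lt]
  constructor <;> linarith

end Birkhoff

section Generic

variable {A : Type*} [TopologicalSpace A] {X : Subshift A ℤ}

lemma continuous_shiftMap : Continuous (shiftMap X) :=
  ((continuous_shift 1).comp continuous_subtype_val).subtype_mk _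

instance compactSpace_carrier [Finite A] : CompactSpace X.carrier :=
  isCompact_iff_compactSpace.1 X.isClosed.isCompact

variable [Finite A] [DiscreteTopology A] [MeasurableSpace A] [BorelSpace A]

/-- Almost every point is generic for an ergodic measure. -/
lemma ae_isGeneric {μ : Measure X.carrier} [IsProbabilityMeasure μ]
    (hμ : Ergodic (shiftMap X) μ) : ∀ᵐ x ∂μ, IsGeneric x μ := by
  have key : ∀ k : ℕ, ∀ᵐ x ∂μ,
      Tendsto (fun n => birkhoffAverage ℝ (shiftMap X)
        (TopologicalSpace.denseSeq C(X.carrier, ℝ) k) n x) atTop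
        (𝓝 (∫ z, TopologicalSpace.denseSeq C(X.carrier, ℝ) k z ∂μ)) := fun k =>
    ae_tendsto_birkhoffAverage hμ (ContinuousMap.continuous _).measurable
      ((BoundedContinuousFunction.mkOfCompact _).integrable μ)
  -- Averages and integrals are 1-Lipschitz in the function, so a dense sequence suffices.
  filter_upwards [ae_all_iff.2 key] with x hx f hf
  rw [Metric.tendsto_nhds]
  intro ε hε
  have hε3 : 0 < ε / 3 := by positivity
  obtain ⟨k, hk⟩ :=
    (TopologicalSpace.denseRange_denseSeq C(X.carrier, ℝ)).exists_dist_lt ⟨f, hf⟩ hε3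
  set g := TopologicalSpace.denseSeq C(X.carrier, ℝ) k with hg
  have hfg : ∀ z, |f z - g z| ≤ ε / 3 := fun z =>
    ((ContinuousMap.dist_apply_le_dist (f := ⟨f, hf⟩) (g := g) z).trans hk.le)
  filter_upwards [(Metric.tendsto_nhds.1 (hx k)) (ε / 3) hε3, eventually_gt_atTop 0] with n hn hn0
  have hn0' : (0 : ℝ) < n := by exact_mod_cast hn0
  have h1 : |birkhoffAverage ℝ (shiftMap X) f n x - birkhoffAverage ℝ (shiftMap X) g n x| ≤
      ε / 3 := by
    simp only [birkhoffAverage, birkhoffSum, smul_eq_mul]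
    rw [← mul_sub, ← Finset.sum_sub_distrib, abs_mul, abs_of_pos (inv_pos.2 hn0'),
      inv_mul_le_iff₀ hn0']
    refine (Finset.abs_sum_le_sum_abs _ _).trans ((Finset.sum_le_sum fun i _ => hfg _).trans ?_)
    simp
  have h2 : |∫ z, f z ∂μ - ∫ z, g z ∂μ| ≤ ε / 3 := by
    have i1 : Integrable f μ := (BoundedContinuousFunction.mkOfCompact ⟨f, hf⟩).integrable μ
    have i2 : Integrable g μ := (BoundedContinuousFunction.mkOfCompact g).integrable μ
    rw [← integral_sub i1 i2]
    simpa using norm_integral_le_of_norm_le_const (μ := μ) (f := fun z => f z - g z)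
      (ae_of_all _ hfg)
  rw [Real.dist_eq] at hn ⊢
  rw [abs_le] at h1 h2
  rw [abs_lt] at hn ⊢
  constructor <;> linarith [h1.1, h1.2, h2.1, h2.2, hn.1, hn.2]

/-- A point is generic for at most one probability measure. -/
lemma IsGeneric.measure_eq {x : X.carrier} {μ μ' : Measure X.carrier} [IsProbabilityMeasure μ]
    [IsProbabilityMeasure μ'] (h : IsGeneric x μ) (h' : IsGeneric x μ') : μ = μ' :=
  ext_of_forall_integral_eq_of_IsFiniteMeasure fun f =>
    tendsto_nhds_unique (h f f.continuous) (h' f f.continuous)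

end Generic

/-! ### Ergodic lifts to extensions with finite fibers -/

section FiberCount

open scoped ENNReal

variable {Z Y : Type*} [TopologicalSpace Z] [MeasurableSpace Z] [BorelSpace Z]
  [TopologicalSpace Y] [T2Space Y] [MeasurableSpace Y] [BorelSpace Y]
  {p : Z → Y} {S : Z → Z} {T : Y → Y} {ν : Measure Y}

/-- The counting measure on the fiber of `p` over `y`. -/
noncomputable def fiberCount (p : Z → Y) (y : Y) : Measure Z :=
  Measure.count.restrict (p ⁻¹' {y})

lemma fiberCount_apply (hp : Continuous p) (y : Y) {E : Set Z} (hE : MeasurableSet E) :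
    fiberCount p y E = ((E ∩ p ⁻¹' {y}).encard : ℝ≥0∞) := by
  have hpy : MeasurableSet (p ⁻¹' {y}) := hp.measurable (measurableSet_singleton y)
  rw [fiberCount, Measure.restrict_apply hE, Measure.count_apply (hE.inter hpy)]

variable [CompactSpace Z] [T2Space Z] [SecondCountableTopology Z]

/-- The number of points of a fiber in a closed set is a supremum of countably many functions, each
of which counts the members of a finite disjoint family of basic closed sets that meet the fiber
in the given set. -/
lemma measurable_fiberCount_of_isClosed (hp : Continuous p) (hfin : ∀ y, (p ⁻¹' {y}).Finite)
    {K : Set Z} (hK : IsClosed K) : Measurable fun y => fiberCount p y K := by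
  classical
  let I := {s : Finset (TopologicalSpace.countableBasis Z) //
    (s : Set (TopologicalSpace.countableBasis Z)).PairwiseDisjoint fun b => closure b.1}
  have : Countable (TopologicalSpace.countableBasis Z) :=
    (TopologicalSpace.countable_countableBasis Z).to_subtype
  have hmeas : ∀ b : TopologicalSpace.countableBasis Z, MeasurableSet (p '' (K ∩ closure b.1)) :=
    fun b => ((hK.inter isClosed_closure).isCompact.image hp).isClosed.measurableSet
  have heq : (fun y => fiberCount p y K) = fun y => ⨆ s : I, ∑ b ∈ s.1,
      (p '' (K ∩ closure b.1)).indicator (fun _ => (1 : ℝ≥0∞)) y := by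
    funext y
    refine le_antisymm ?_ (iSup_le fun s => ?_)
    · have hf : (K ∩ p ⁻¹' {y}).Finite := (hfin y).inter_of_right K
      obtain ⟨U, hU, hdisj⟩ := hf.t2_separation
      have hb : ∀ z, ∃ b ∈ TopologicalSpace.countableBasis Z, z ∈ b ∧ closure b ⊆ U z := fun z =>
        (TopologicalSpace.isBasis_countableBasis Z).exists_closure_subset
          ((hU z).2.mem_nhds (hU z).1)
      choose b hbB hzb hbU using hb
      have hinj : Set.InjOn (fun z => (⟨b z, hbB z⟩ : TopologicalSpace.countableBasis Z))
          hf.toFinset := by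
        intro z hz z' hz' h
        by_contra hne
        have h' : b z = b z' := congrArg Subtype.val h
        exact Set.disjoint_left.1
          (hdisj (hf.mem_toFinset.1 hz) (hf.mem_toFinset.1 hz') hne)
          (hbU z (subset_closure (hzb z))) (hbU z' (subset_closure (h' ▸ hzb z)))
      refine le_iSup_of_le ⟨hf.toFinset.image fun z => ⟨b z, hbB z⟩, ?_⟩ ?_
      · intro c hc c' hc' hne
        obtain ⟨z, hz, rfl⟩ := Finset.mem_image.1 hc
        obtain ⟨z', hz', rfl⟩ := Finset.mem_image.1 hc'
        exact (hdisj (hf.mem_toFinset.1 hz) (hf.mem_toFinset.1 hz')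
          (fun h => hne (by rw [h]))).mono (hbU z) (hbU z')
      · simp only
        rw [Finset.sum_image hinj, fiberCount_apply hp y hK.measurableSet,
          hf.encard_eq_coe_toFinset_card]
        have h1 : ∀ z ∈ hf.toFinset, (p '' (K ∩ closure (b z))).indicator
            (fun _ => (1 : ℝ≥0∞)) y = 1 := fun z hz => by
          obtain ⟨hzK, hzy⟩ := hf.mem_toFinset.1 hz
          have : y ∈ p '' (K ∩ closure (b z)) := ⟨z, ⟨hzK, subset_closure (hzb z)⟩, hzy⟩
          exact Set.indicator_of_mem this _
        rw [Finset.sum_congr rfl h1]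
        simp
    · calc ∑ b ∈ s.1, (p '' (K ∩ closure b.1)).indicator (fun _ => (1 : ℝ≥0∞)) y
          ≤ ∑ b ∈ s.1, fiberCount p y (K ∩ closure b.1) := by
            refine Finset.sum_le_sum fun b _ => ?_
            rw [fiberCount_apply hp y (hK.inter isClosed_closure).measurableSet]
            refine Set.indicator_apply_le' ?_ fun _ => zero_le
            rintro ⟨z, hz, hzy⟩
            have : 1 ≤ (K ∩ closure b.1 ∩ p ⁻¹' {y}).encard :=
              Set.one_le_encard_iff_nonempty.2 ⟨z, hz, hzy⟩
            exact_mod_cast this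
        _ = fiberCount p y (⋃ b ∈ s.1, K ∩ closure b.1) := by
            refine (measure_biUnion_finset (fun b hb b' hb' hne => ?_) fun b _ =>
              (hK.inter isClosed_closure).measurableSet).symm
            exact (s.2 hb hb' hne).mono Set.inter_subset_right Set.inter_subset_right
        _ ≤ fiberCount p y K := measure_mono (Set.iUnion₂_subset fun b _ => Set.inter_subset_left)
  rw [heq]
  exact .iSup fun s => Finset.measurable_sum _ fun b _ => measurable_const.indicator (hmeas b)

/-- The counting measures on finite fibers depend measurably on the base point. Finiteness allows
to pass to complements. -/
lemma measurable_fiberCount (hp : Continuous p) (hfin : ∀ y, (p ⁻¹' {y}).Finite) :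
    Measurable (fiberCount p) := by
  have hlt : ∀ y, fiberCount p y Set.univ < ∞ := fun y => by
    rw [fiberCount_apply hp y .univ, Set.univ_inter, (hfin y).encard_eq_coe_toFinset_card]
    simp
  refine Measure.measurable_of_measurable_coe _ fun s hs => ?_
  refine MeasurableSpace.induction_on_inter (C := fun s _ => Measurable fun y => fiberCount p y s)
    (BorelSpace.measurable_eq.trans borel_eq_generateFrom_isClosed) isPiSystem_isClosed ?_
    (fun K hK => measurable_fiberCount_of_isClosed hp hfin hK) (fun t ht ih => ?_)
    (fun f hd hf ih => ?_) s hs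
  · simp
  · have : (fun y => fiberCount p y tᶜ) = fun y => fiberCount p y Set.univ - fiberCount p y t :=
      funext fun y => measure_compl ht ((measure_mono (Set.subset_univ t)).trans_lt (hlt y)).ne
    rw [this]
    exact (measurable_fiberCount_of_isClosed hp hfin isClosed_univ).sub ih
  · simp only [measure_iUnion hd hf]
    exact .tsum ih

/-- An invariant set that meets almost every fiber of an extension with finite fibers carries an
ergodic lift of the ergodic measure `ν`. The mass that the integral of the counting measures on
the fibers gives to an invariant set is an integer, so there is an invariant set of least positive
mass, and the normalised restriction to it is ergodic. -/
theorem exists_ergodic_lift_of_finite_fibers [IsProbabilityMeasure ν] (hp : Continuous p)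
    (hfin : ∀ y, (p ⁻¹' {y}).Finite) (hS : Measurable S) (hSb : Function.Bijective S)
    (hTi : Function.Injective T) (hST : ∀ z, p (S z) = T (p z)) (hν : Ergodic T ν)
    {D : Set Z} (hD : MeasurableSet D) (hDS : S ⁻¹' D = D)
    (hDν : ∀ᵐ y ∂ν, (D ∩ p ⁻¹' {y}).Nonempty) :
    ∃ μ : Measure Z, IsProbabilityMeasure μ ∧ Ergodic S μ ∧ μ.map p = ν ∧ ∀ᵐ z ∂μ, z ∈ D := by
  have hm := measurable_fiberCount hp hfin
  have hmE : ∀ E : Set Z, MeasurableSet E → Measurable fun y => fiberCount p y E :=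
    fun E hE => (Measure.measurable_coe hE).comp hm
  have hshift : ∀ E : Set Z, MeasurableSet E → ∀ y,
      fiberCount p y (S ⁻¹' E) = fiberCount p (T y) E := by
    intro E hE y
    rw [fiberCount_apply hp y (hS hE), fiberCount_apply hp (T y) hE,
      ← Set.encard_preimage_of_bijective hSb (E ∩ p ⁻¹' {T y})]
    congr 2
    ext z
    simp [hST, hTi.eq_iff]
  set m : Measure Z := ν.bind (fiberCount p) with hmdef
  have hmapp : ∀ E : Set Z, MeasurableSet E → m E = ∫⁻ y, fiberCount p y E ∂ν :=
    fun E hE => Measure.bind_apply hE hm.aemeasurable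
  have hminv : MeasurePreserving S m m := by
    refine ⟨hS, Measure.ext fun E hE => ?_⟩
    rw [Measure.map_apply hS hE, hmapp _ (hS hE), hmapp _ hE]
    simp only [hshift E hE]
    exact hν.toMeasurePreserving.lintegral_comp (hmE E hE)
  -- The number of points of `E` in a fiber is an invariant function of the base point, hence
  -- almost everywhere constant.
  have hconst : ∀ E : Set Z, MeasurableSet E → S ⁻¹' E = E →
      ∃ k : ℕ, (∀ᵐ y ∂ν, fiberCount p y E = k) ∧ m E = k := by
    intro E hE hES
    obtain ⟨c, hc⟩ := hν.toPreErgodic.ae_eq_const_of_ae_eq_comp (hmE E hE) (by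
      funext y
      simp only [Function.comp]
      rw [← hshift E hE, hES])
    obtain ⟨y, hy⟩ := hc.exists
    have hk : c = ((E ∩ p ⁻¹' {y}).ncard : ℝ≥0∞) := by
      rw [← (show fiberCount p y E = c from hy), fiberCount_apply hp y hE,
        ← ((hfin y).inter_of_right E).cast_ncard_eq]
      simp
    refine ⟨(E ∩ p ⁻¹' {y}).ncard, by rw [← hk]; exact hc, ?_⟩
    rw [hmapp E hE, lintegral_congr_ae hc, ← hk]
    simp
  let P : ℕ → Prop := fun k => 0 < k ∧ ∃ E ⊆ D, MeasurableSet E ∧ S ⁻¹' E = E ∧ m E = k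
  have hP : ∃ k, P k := by
    obtain ⟨k, hk, hmk⟩ := hconst D hD hDS
    refine ⟨k, ?_, D, subset_rfl, hD, hDS, hmk⟩
    obtain ⟨y, hy, hy'⟩ := (hk.and hDν).exists
    rw [fiberCount_apply hp y hD] at hy
    rcases Nat.eq_zero_or_pos k with rfl | h
    · simp only [Nat.cast_zero] at hy
      have : (D ∩ p ⁻¹' {y}).encard = 0 := by exact_mod_cast hy
      exact absurd (Set.encard_eq_zero.1 this) hy'.ne_empty
    · exact h
  classical
  obtain ⟨hk0, E, hED, hE, hES, hmk⟩ := Nat.find_spec hP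
  set k := Nat.find hP
  have hk0' : (k : ℝ≥0∞) ≠ 0 := by exact_mod_cast hk0.ne'
  have hkt : (k : ℝ≥0∞) ≠ ∞ := ENNReal.natCast_ne_top k
  have hEk : ∀ᵐ y ∂ν, fiberCount p y E = k := by
    obtain ⟨k', hk', hmk'⟩ := hconst E hE hES
    have : k' = k := by rw [hmk] at hmk'; exact_mod_cast hmk'.symm
    exact this ▸ hk'
  refine ⟨(k : ℝ≥0∞)⁻¹ • m.restrict E, ⟨?_⟩, ⟨?_, ⟨fun s hs hSs => ?_⟩⟩, ?_, ?_⟩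
  · simp [hmk, ENNReal.inv_mul_cancel hk0' hkt]
  · have := hminv.restrict_preimage hE
    rw [hES] at this
    exact this.smul_measure _
  · -- An invariant part of `E` has mass `0` or, by the minimality of `k`, the mass of `E`.
    rw [eventuallyConst_set]
    obtain ⟨j, -, hj⟩ := hconst (s ∩ E) (hs.inter hE) (by rw [Set.preimage_inter, hSs, hES])
    rcases Nat.eq_zero_or_pos j with rfl | hj0
    · right
      rw [ae_iff]
      simp [Measure.restrict_apply hs, hj]
    · left
      have hkj : k ≤ j := Nat.find_min' hP
        ⟨hj0, s ∩ E, Set.inter_subset_right.trans hED, hs.inter hE,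
          by rw [Set.preimage_inter, hSs, hES], hj⟩
      have h1 : m (s ∩ E) = m E := by
        refine le_antisymm (measure_mono Set.inter_subset_right) ?_
        rw [hmk, hj]
        exact_mod_cast hkj
      have h2 : m (sᶜ ∩ E) = 0 := by
        have h3 := measure_inter_add_sdiff (μ := m) E hs
        rw [Set.inter_comm, h1, hmk, Set.sdiff_eq, Set.inter_comm] at h3
        exact (ENNReal.add_right_inj hkt).1 (by rw [h3, add_zero])
      rw [ae_iff]
      simp only [← Set.mem_compl_iff, Set.ofPred_mem_eq]
      simp [Measure.restrict_apply hs.compl, h2]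
  · refine Measure.ext fun B hB => ?_
    have hpB : MeasurableSet (p ⁻¹' B) := hp.measurable hB
    rw [Measure.map_apply hp.measurable hB, Measure.smul_apply, Measure.restrict_apply hpB,
      hmapp _ (hpB.inter hE), smul_eq_mul]
    have h1 : ∀ᵐ y ∂ν, fiberCount p y (p ⁻¹' B ∩ E) = B.indicator (fun _ => (k : ℝ≥0∞)) y := by
      filter_upwards [hEk] with y hy
      rw [fiberCount_apply hp y (hpB.inter hE)]
      rw [fiberCount_apply hp y hE] at hy
      by_cases hyB : y ∈ B
      · rw [Set.indicator_of_mem hyB, ← hy]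
        congr 2
        ext z
        simp only [Set.mem_inter_iff, Set.mem_preimage, Set.mem_singleton_iff]
        exact ⟨fun h => ⟨h.1.2, h.2⟩, fun h => ⟨⟨h.2 ▸ hyB, h.1⟩, h.2⟩⟩
      · rw [Set.indicator_of_notMem hyB]
        have : p ⁻¹' B ∩ E ∩ p ⁻¹' {y} = ∅ := by
          refine Set.eq_empty_of_forall_notMem fun z hz => hyB ?_
          obtain ⟨⟨h1, -⟩, h2⟩ := hz
          exact (show p z = y from h2) ▸ h1
        simp [this]
    rw [lintegral_congr_ae h1, lintegral_indicator_const hB, ← mul_assoc,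
      ENNReal.inv_mul_cancel hk0' hkt, one_mul]
  · refine Measure.ae_smul_measure ?_ _
    filter_upwards [ae_restrict_mem hE] with z hz using hED hz

end FiberCount

/-! ### Recurrence and degree joinings -/

section Recurrence

/-- An ergodic probability preserving map visits every set of positive measure infinitely often,
from almost every starting point. -/
lemma ae_frequently_iterate_mem {α : Type*} [MeasurableSpace α] {μ : Measure α}
    [IsFiniteMeasure μ] {T : α → α} (hT : Ergodic T μ) {U : Set α} (hU : MeasurableSet U)
    (hpos : μ U ≠ 0) : ∀ᵐ x ∂μ, ∃ᶠ n in atTop, T^[n] x ∈ U := by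
  set D := {x | ∃ᶠ n in atTop, T^[n] x ∈ U} with hDdef
  have hD : MeasurableSet D := by
    simp only [hDdef, frequently_atTop, Set.ofPred_forall, Set.ofPred_exists, Set.ofPred_and]
    exact .iInter fun N => .iUnion fun n =>
      (MeasurableSet.const _).inter (hT.measurable.iterate n hU)
  have hinv : T ⁻¹' D = D := by
    ext x
    have h : T x ∈ D ↔ ∃ᶠ n in atTop, T^[n + 1] x ∈ U := Iff.rfl
    rw [Set.mem_preimage, h, ← frequently_map (m := fun n => n + 1) (P := fun n => T^[n] x ∈ U),
      map_add_atTop_eq_nat]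
    rfl
  rcases hT.toPreErgodic.ae_mem_or_ae_notMem hD hinv with h | h
  · exact h
  · refine absurd ?_ hpos
    have hcons := hT.toMeasurePreserving.conservative.ae_mem_imp_frequently_image_mem
      hU.nullMeasurableSet
    have : ∀ᵐ x ∂μ, x ∉ U := by
      filter_upwards [h, hcons] with x h1 h2 h3 using h1 (h2 h3)
    rw [ae_iff] at this
    simpa using this

variable {B : Type*} [TopologicalSpace B] [MeasurableSpace B] {Y : Subshift B ℤ}

variable (Y) in
/-- The shift of a shift space as a measurable equivalence. -/
def shiftEquiv [DiscreteTopology B] [Finite B] [BorelSpace B] : Y.carrier ≃ᵐ Y.carrier where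
  toFun := shiftMap Y
  invFun := fun x => ⟨shift (-1) (x : ℤ → B), Y.mapsTo (-1) x.2⟩
  left_inv x := by ext i; simp [shiftMap]
  right_inv x := by ext i; simp [shiftMap]
  measurable_toFun := continuous_shiftMap.measurable
  measurable_invFun :=
    (((continuous_shift (-1)).comp continuous_subtype_val).subtype_mk _).measurable

variable [DiscreteTopology B] [Finite B] [BorelSpace B]

lemma shiftEquiv_iterate (n : ℕ) (y : Y.carrier) (i : ℤ) :
    ((shiftEquiv Y)^[n] y).1 i = y.1 (n + i) := by
  induction n generalizing y with
  | zero => simp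
  | succ n ih =>
    rw [Function.iterate_succ_apply, ih]
    change y.1 (1 + (n + i)) = _
    exact congrArg y.1 (by push_cast; ring)

lemma shiftEquiv_symm_iterate (n : ℕ) (y : Y.carrier) (i : ℤ) :
    ((shiftEquiv Y).symm^[n] y).1 i = y.1 (-n + i) := by
  induction n generalizing y with
  | zero => simp
  | succ n ih =>
    rw [Function.iterate_succ_apply, ih]
    change y.1 (-1 + (-n + i)) = _
    exact congrArg y.1 (by push_cast; ring)

/-- Almost every point is doubly transitive for a fully supported ergodic measure. -/
lemma ae_isDoublyTransitive {ν : Measure Y.carrier} [IsProbabilityMeasure ν]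
    [ν.IsOpenPosMeasure] (hν : Ergodic (shiftMap Y) ν) : ∀ᵐ y ∂ν, IsDoublyTransitive Y y := by
  have h1 : Ergodic (shiftEquiv Y) ν := hν
  have key : ∀ u : List B, u ∈ language Y → ∀ᵐ y ∂ν,
      (∃ᶠ n in atTop, (shiftEquiv Y)^[n] y ∈ {y : Y.carrier | Reads y.1 0 u}) ∧
      ∃ᶠ n in atTop, (shiftEquiv Y).symm^[n] y ∈ {y : Y.carrier | Reads y.1 0 u} := by
    intro u hu
    have ho := isOpen_setOf_reads (X := Y) 0 u
    have hpos : ν {y : Y.carrier | Reads y.1 0 u} ≠ 0 := by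
      obtain ⟨y, hy, hr⟩ := mem_language_at hu 0
      exact ho.measure_ne_zero ν ⟨⟨y, hy⟩, hr⟩
    exact (ae_frequently_iterate_mem h1 ho.measurableSet hpos).and
      (ae_frequently_iterate_mem h1.symm ho.measurableSet hpos)
  have := ae_all_iff.2 fun u => eventually_imp_distrib_left.2 (key u)
  filter_upwards [this] with y hy u hu N
  obtain ⟨hf, hb⟩ := hy u hu
  obtain ⟨n, hn, hr⟩ := frequently_atTop.1 hf N.toNat
  obtain ⟨k, hk, hr'⟩ := frequently_atTop.1 hb (-N).toNat
  refine ⟨⟨n, by omega, fun j hj => ?_⟩, ⟨-k, by omega, fun j hj => ?_⟩⟩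
  · have := hr j hj
    rwa [shiftEquiv_iterate, zero_add] at this
  · have := hr' j hj
    rwa [shiftEquiv_symm_iterate, zero_add] at this

end Recurrence

section Joinings

variable {A B : Type*}
    [Finite A] [TopologicalSpace A] [DiscreteTopology A] [MeasurableSpace A] [BorelSpace A]
    [TopologicalSpace B] [MeasurableSpace B]
    {X : Subshift A ℤ} {Y : Subshift B ℤ} {π : X.carrier → Y.carrier} {ν : Measure Y.carrier}

/-- The margins of a degree joining are ergodic lifts. -/
lemma IsDegreeJoining.isErgodicLift_margin {ρ : Measure (Fin (degree π) → X.carrier)}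
    (hρ : IsDegreeJoining π ν ρ) (i : Fin (degree π)) : IsErgodicLift π ν (margin ρ i) := by
  have := hρ.joining.prob
  have hev : MeasurePreserving (fun z : Fin (degree π) → X.carrier => z i) ρ (margin ρ i) :=
    ⟨measurable_pi_apply i, rfl⟩
  exact ⟨Measure.isProbabilityMeasure_map (measurable_pi_apply i).aemeasurable,
    hev.ergodic_of_ergodic_semiconj hρ.ergodic continuous_shiftMap.measurable (fun _ => rfl),
    hρ.joining.image_eq i⟩

variable [Finite B] [DiscreteTopology B] [BorelSpace B]

lemma measurable_powShift (n : ℕ) : Measurable (powShift X n) :=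
  measurable_pi_lambda _ fun i => continuous_shiftMap.measurable.comp (measurable_pi_apply i)

lemma bijective_shiftMap : Function.Bijective (shiftMap X) := (shiftEquiv X).bijective

/-- If almost all fibers have `degree π` points, there is a degree joining: the injective
enumerations of the fibers form an invariant set of tuples that meets almost all fibers. -/
theorem exists_isDegreeJoining [IsProbabilityMeasure ν] (hπ : IsFactorCode X Y π)
    (hfin : IsFiniteToOne π) (hν : Ergodic (shiftMap Y) ν)
    (hdeg : ∀ᵐ y ∂ν, (π ⁻¹' {y}).encard = degree π) :
    ∃ ρ : Measure (Fin (degree π) → X.carrier), IsDegreeJoining π ν ρ := by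
  have hd : 0 < degree π := by
    obtain ⟨y, hy⟩ := hdeg.exists
    obtain ⟨x, hx⟩ := hπ.surjective y
    rw [Nat.pos_iff_ne_zero]
    intro h0
    rw [h0, Nat.cast_zero, Set.encard_eq_zero] at hy
    exact (hy ▸ (show x ∈ π ⁻¹' {y} from hx) : x ∈ (∅ : Set X.carrier))
  let i₀ : Fin (degree π) := ⟨0, hd⟩
  -- The tuples within a fiber form an extension of `Y` with finite fibers.
  let F : Set (Fin (degree π) → X.carrier) := {z | ∀ i j, π (z i) = π (z j)}
  have hF : IsClosed F := by
    simp only [F, Set.ofPred_forall]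
    exact isClosed_iInter fun i => isClosed_iInter fun j =>
      isClosed_eq (hπ.continuous.comp (continuous_apply i))
        (hπ.continuous.comp (continuous_apply j))
  have : CompactSpace F := isCompact_iff_compactSpace.1 hF.isCompact
  let p : F → Y.carrier := fun z => π (z.1 i₀)
  have hp : Continuous p := hπ.continuous.comp ((continuous_apply i₀).comp continuous_subtype_val)
  have hpi : ∀ (z : F) i, π (z.1 i) = p z := fun z i => z.2 i i₀
  have hpfin : ∀ y, (p ⁻¹' {y}).Finite := fun y => by
    refine Set.Finite.of_finite_image ((Set.Finite.pi' fun _ : Fin (degree π) => hfin y).subset ?_)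
      Subtype.val_injective.injOn
    rintro _ ⟨z, hz, rfl⟩ i
    exact (hpi z i).trans hz
  have hFS : ∀ z ∈ F, powShift X _ z ∈ F := fun z hz i j => by
    simp only [powShift, hπ.commutes, hz i j]
  let S : F → F := fun z => ⟨powShift X _ z.1, hFS _ z.2⟩
  have hS : Measurable S := ((measurable_powShift _).comp measurable_subtype_coe).subtype_mk
  have hSb : Function.Bijective S := by
    constructor
    · intro z z' h
      have h' := congrArg Subtype.val h
      exact Subtype.ext (funext fun i => bijective_shiftMap.injective (congrFun h' i))
    · intro z
      choose w hw using fun i => bijective_shiftMap.surjective (z.1 i)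
      refine ⟨⟨w, fun i j => bijective_shiftMap.injective ?_⟩, Subtype.ext (funext hw)⟩
      rw [← hπ.commutes, ← hπ.commutes, hw, hw]
      exact z.2 i j
  let D : Set F := {z | Function.Injective z.1}
  have hIo : IsOpen {z : Fin (degree π) → X.carrier | Function.Injective z} := by
    have : {z : Fin (degree π) → X.carrier | Function.Injective z} =
        ⋂ i, ⋂ j, {z | i ≠ j → z i ≠ z j} := by
      ext z
      simp only [Set.mem_iInter, Set.mem_ofPred_eq]
      exact ⟨fun h i j hij => h.ne hij, fun h i j hij => by_contra fun hne => h i j hne hij⟩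
    rw [this]
    refine isOpen_iInter_of_finite fun i => isOpen_iInter_of_finite fun j => ?_
    by_cases hij : i = j
    · simp [hij]
    · simpa [hij] using isOpen_ne_fun (continuous_apply (A := fun _ => X.carrier) i)
        (continuous_apply (A := fun _ => X.carrier) j)
  have hD : MeasurableSet D := (hIo.preimage continuous_subtype_val).measurableSet
  have hDS : S ⁻¹' D = D := by
    ext z
    exact bijective_shiftMap.injective.of_comp_iff (f := shiftMap X) z.1
  have hDν : ∀ᵐ y ∂ν, (D ∩ p ⁻¹' {y}).Nonempty := by
    filter_upwards [hdeg] with y hy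
    have := (hfin y).to_subtype
    have hcard : Nat.card (π ⁻¹' {y}) = degree π := by
      rw [Nat.card_coe_set_eq, Set.ncard, hy]; rfl
    let e := (Finite.equivFinOfCardEq hcard).symm
    exact ⟨⟨fun i => (e i).1, fun i j => (e i).2.trans (e j).2.symm⟩,
      Subtype.val_injective.comp e.injective, (e i₀).2⟩
  obtain ⟨lam, hprob, hergo, hmap, hlamD⟩ := exists_ergodic_lift_of_finite_fibers hp hpfin hS hSb
    bijective_shiftMap.injective (fun z => hπ.commutes _) hν hD hDS hDν
  have hval : MeasurePreserving (Subtype.val : F → _) lam (lam.map Subtype.val) :=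
    ⟨measurable_subtype_coe, rfl⟩
  have hrho := hval.ergodic_of_ergodic_semiconj hergo (measurable_powShift _)
    (fun z => rfl : Function.Semiconj Subtype.val S (powShift X _))
  refine ⟨lam.map Subtype.val, ⟨⟨?_, hrho.toMeasurePreserving, ?_, fun i => ?_⟩, hrho, ?_⟩⟩
  · exact Measure.isProbabilityMeasure_map measurable_subtype_coe.aemeasurable
  · exact (ae_map_iff measurable_subtype_coe.aemeasurable hF.measurableSet).2
      (ae_of_all _ fun z => z.2)
  · rw [margin, Measure.map_map hπ.continuous.measurable (measurable_pi_apply i),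
      Measure.map_map (hπ.continuous.measurable.comp (measurable_pi_apply i))
        measurable_subtype_coe, ← hmap]
    congr 1
    funext z
    exact hpi z i
  · exact (ae_map_iff measurable_subtype_coe.aemeasurable hIo.measurableSet).2 hlamD

/-- Almost sure properties of images are almost sure for the image measure, without any
measurability of the property: the property holds on images of compact sets of almost full
measure. -/
lemma ae_map_of_ae_of_continuous {Z W : Type*} [TopologicalSpace Z] [T2Space Z] [MeasurableSpace Z]
    [BorelSpace Z] [TopologicalSpace W] [T2Space W] [MeasurableSpace W] [BorelSpace W]
    {ρ : Measure Z} [IsFiniteMeasure ρ] [ρ.InnerRegularCompactLTTop] {g : Z → W}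
    (hg : Continuous g) {P : W → Prop} (h : ∀ᵐ z ∂ρ, P (g z)) : ∀ᵐ w ∂(ρ.map g), P w := by
  obtain ⟨G, hG, hGm, hG0⟩ := exists_measurable_superset_of_null (ae_iff.1 h)
  rw [ae_iff]
  refine le_antisymm (le_of_forall_pos_le_add fun ε hε => ?_) (zero_le)
  obtain ⟨K, hKG, hK, hlt⟩ := hGm.compl.exists_isCompact_sdiff_lt (measure_ne_top ρ _) hε.ne'
  calc ρ.map g {w | ¬ P w} ≤ ρ.map g (g '' K)ᶜ := measure_mono fun w hw hwK => by
        obtain ⟨z, hz, rfl⟩ := hwK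
        exact hKG hz (hG hw)
    _ = ρ (g ⁻¹' (g '' K)ᶜ) := Measure.map_apply hg.measurable
        (hK.image hg).isClosed.measurableSet.compl
    _ ≤ ρ (G ∪ (Gᶜ \ K)) := measure_mono fun z hz => by
        by_cases hzG : z ∈ G
        · exact .inl hzG
        · exact .inr ⟨hzG, fun hzK => hz ⟨z, hzK, rfl⟩⟩
    _ ≤ ρ G + ρ (Gᶜ \ K) := measure_union_le _ _
    _ ≤ 0 + ε := add_le_add hG0.le hlt.le

/-- A degree joining enumerates almost every fiber, each point of which is generic for the
corresponding margin. -/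
lemma IsDegreeJoining.ae_fiber [IsProbabilityMeasure ν] (hπ : IsFactorCode X Y π)
    (hdeg : ∀ᵐ y ∂ν, (π ⁻¹' {y}).encard = degree π)
    {ρ : Measure (Fin (degree π) → X.carrier)} (hρ : IsDegreeJoining π ν ρ) :
    ∀ᵐ y ∂ν, ∃ z : Fin (degree π) → X.carrier, Function.Injective z ∧ Set.range z = π ⁻¹' {y} ∧
      ∀ i, IsGeneric (z i) (margin ρ i) := by
  have := hρ.joining.prob
  rcases Nat.eq_zero_or_pos (degree π) with h0 | hd
  · filter_upwards [hdeg] with y hy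
    rw [h0, Nat.cast_zero, Set.encard_eq_zero] at hy
    obtain ⟨x, hx⟩ := hπ.surjective y
    exact absurd (show x ∈ π ⁻¹' {y} from hx) (by simp [hy])
  let i₀ : Fin (degree π) := ⟨0, hd⟩
  have hg : Continuous fun z : Fin (degree π) → X.carrier => π (z i₀) :=
    hπ.continuous.comp (continuous_apply i₀)
  have hνmap : ρ.map (fun z => π (z i₀)) = ν := by
    rw [← hρ.joining.image_eq i₀, margin,
      Measure.map_map hπ.continuous.measurable (measurable_pi_apply i₀)]
    rfl
  rw [← hνmap]
  refine ae_map_of_ae_of_continuous hg ?_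
  have hgen : ∀ᵐ z ∂ρ, ∀ i, IsGeneric (z i) (margin ρ i) := by
    refine ae_all_iff.2 fun i => ?_
    have hi := hρ.isErgodicLift_margin i
    have := hi.prob
    exact ae_of_ae_map (measurable_pi_apply i).aemeasurable (ae_isGeneric hi.ergodic)
  have hcard : ∀ᵐ z ∂ρ, (π ⁻¹' {π (z i₀)}).encard = degree π := by
    rw [← hνmap] at hdeg
    exact ae_of_ae_map hg.measurable.aemeasurable hdeg
  filter_upwards [hgen, hcard, hρ.separating, hρ.joining.common_image] with z h1 h2 h3 h4
  refine ⟨z, h3, (Set.finite_range z).eq_of_subset_of_encard_le ?_ ?_, h1⟩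
  · rintro _ ⟨i, rfl⟩
    exact h4 i i₀
  · rw [h2, ← Set.image_univ, h3.encard_image, Set.encard_univ]
    simp

/-- Over almost every point, the points of the fiber that are generic for `μ` are counted by the
margins of any degree joining that are equal to `μ`. -/
lemma IsDegreeJoining.ae_encard_generic [IsProbabilityMeasure ν] (hπ : IsFactorCode X Y π)
    (hdeg : ∀ᵐ y ∂ν, (π ⁻¹' {y}).encard = degree π)
    {ρ : Measure (Fin (degree π) → X.carrier)} (hρ : IsDegreeJoining π ν ρ) :
    ∀ᵐ y ∂ν, ∀ μ : Measure X.carrier, IsProbabilityMeasure μ →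
      {x | π x = y ∧ IsGeneric x μ}.encard = marginCount ρ μ := by
  filter_upwards [hρ.ae_fiber hπ hdeg] with y ⟨z, hz, hzy, hgen⟩ μ hμ
  have : {x | π x = y ∧ IsGeneric x μ} = z '' {i | margin ρ i = μ} := by
    ext x
    constructor
    · rintro ⟨hx, hxμ⟩
      obtain ⟨i, rfl⟩ : x ∈ Set.range z := hzy ▸ hx
      have := (hρ.isErgodicLift_margin i).prob
      exact ⟨i, (hgen i).measure_eq hxμ, rfl⟩
    · rintro ⟨i, rfl, rfl⟩
      exact ⟨(hzy ▸ Set.mem_range_self i : z i ∈ π ⁻¹' {y}), hgen i⟩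
  rw [this, hz.encard_image, marginCount]
  exact ((Set.toFinite _).cast_ncard_eq).symm

/-- Every ergodic lift is a margin of any given degree joining, since almost every point for it is
generic both for it and for some margin. -/
lemma IsDegreeJoining.exists_margin_eq [IsProbabilityMeasure ν] (hπ : IsFactorCode X Y π)
    (hdeg : ∀ᵐ y ∂ν, (π ⁻¹' {y}).encard = degree π)
    {ρ : Measure (Fin (degree π) → X.carrier)} (hρ : IsDegreeJoining π ν ρ)
    {μ : Measure X.carrier} (hμ : IsErgodicLift π ν μ) : ∃ i, margin ρ i = μ := by
  have := hμ.prob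
  have h := hρ.ae_fiber hπ hdeg
  rw [← hμ.map_eq] at h
  obtain ⟨x, ⟨z, -, hzx, hgen⟩, hx⟩ :=
    ((ae_of_ae_map hπ.continuous.measurable.aemeasurable h).and (ae_isGeneric hμ.ergodic)).exists
  obtain ⟨i, hi⟩ : x ∈ Set.range z := by rw [hzx]; rfl
  have := (hρ.isErgodicLift_margin i).prob
  exact ⟨i, (hgen i).measure_eq (hi ▸ hx)⟩

end Joinings

end FactorCode

theorem mainTheorem5
    {A B : Type*}
    [Finite A] [TopologicalSpace A] [DiscreteTopology A] [MeasurableSpace A] [BorelSpace A]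
    [Finite B] [TopologicalSpace B] [DiscreteTopology B] [MeasurableSpace B] [BorelSpace B]
    (X : Subshift A ℤ) (Y : Subshift B ℤ)
    (hX_sofic : FactorCode.IsSofic X) (hX_irr : FactorCode.IsIrreducible X)
    (π : X.carrier → Y.carrier)
    (hπ : FactorCode.IsFactorCode X Y π) (hπ_fin : FactorCode.IsFiniteToOne π)
    (ν : Measure Y.carrier) [IsProbabilityMeasure ν] [ν.IsOpenPosMeasure]
    (hν : Ergodic (FactorCode.shiftMap Y) ν) :
    -- there are only finitely many ergodic lifts of `ν`
    {μ : Measure X.carrier | FactorCode.IsErgodicLift π ν μ}.Finite ∧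
    -- their multiplicities can be computed from any degree joining over `ν`
    (∀ ρ : Measure (Fin (FactorCode.degree π) → X.carrier),
      FactorCode.IsDegreeJoining π ν ρ →
        ∀ μ : Measure X.carrier, FactorCode.IsErgodicLift π ν μ →
          FactorCode.marginCount ρ μ = FactorCode.multiplicity π μ) ∧
    -- almost every fiber is partitioned by genericity into sets counted by the multiplicities
    ∀ᵐ y ∂ν,
      (∀ x, π x = y →
        ∃! μ : Measure X.carrier,
          FactorCode.IsErgodicLift π ν μ ∧ FactorCode.IsGeneric x μ) ∧
      (∀ μ : Measure X.carrier, FactorCode.IsErgodicLift π ν μ →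
        {x | π x = y ∧ FactorCode.IsGeneric x μ}.encard = (FactorCode.multiplicity π μ : ℕ∞)) := by
  have hdeg : ∀ᵐ y ∂ν, (π ⁻¹' {y}).encard = FactorCode.degree π := by
    filter_upwards [FactorCode.ae_isDoublyTransitive hν] with y hy
    exact FactorCode.encard_fiber_eq_degree hX_sofic hX_irr hπ hπ_fin hy
  obtain ⟨ρ₀, hρ₀⟩ := FactorCode.exists_isDegreeJoining hπ hπ_fin hν hdeg
  have hmult : ∀ ρ : Measure (Fin (FactorCode.degree π) → X.carrier),
      FactorCode.IsDegreeJoining π ν ρ → ∀ μ : Measure X.carrier,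
        FactorCode.IsErgodicLift π ν μ →
          FactorCode.marginCount ρ μ = FactorCode.multiplicity π μ := by
    intro ρ hρ μ hμ
    have hμν := hμ.map_eq
    have hμp := hμ.prob
    subst hμν
    have hex : ∃ ρ, FactorCode.IsDegreeJoining π (μ.map π) ρ := ⟨ρ, hρ⟩
    rw [FactorCode.multiplicity, dif_pos hex]
    obtain ⟨y, h1, h2⟩ := ((hρ.ae_encard_generic hπ hdeg).and
      (hex.choose_spec.ae_encard_generic hπ hdeg)).exists
    have := (h1 μ hμp).symm.trans (h2 μ hμp)
    exact_mod_cast this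
  refine ⟨(Set.finite_range (FactorCode.margin ρ₀)).subset fun μ hμ =>
    hρ₀.exists_margin_eq hπ hdeg hμ, hmult, ?_⟩
  filter_upwards [hρ₀.ae_fiber hπ hdeg, hρ₀.ae_encard_generic hπ hdeg]
    with y hfib hcount
  obtain ⟨z, -, hzy, hgen⟩ := hfib
  refine ⟨fun x hx => ?_, fun μ hμ => ?_⟩
  · obtain ⟨i, rfl⟩ : x ∈ Set.range z := hzy ▸ hx
    refine ⟨_, ⟨hρ₀.isErgodicLift_margin i, hgen i⟩, fun μ ⟨hμ, hxμ⟩ => ?_⟩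
    have := hμ.prob
    have := (hρ₀.isErgodicLift_margin i).prob
    exact hxμ.measure_eq (hgen i)
  · rw [hcount μ hμ.prob, hmult ρ₀ hρ₀ μ hμ]
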